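/- Let $\mathbb H=\{z\in\mathbb C:\operatorname{Re}z>0\}$ and let $\ell\ge 0$ be an integer. Let $A^2_\ell$ be the Hilbert space of analytic functions $h:\mathbb H\to\mathbb C$ with $$\|h\|^2=\frac1\pi\int_{-\infty}^{\infty}\int_0^\infty x^\ell\,|h(x+iy)|^2\,dx\,dy<\infty .$$ Let $\mathcal C_\star:A^2_\ell\to A^2_\ell$ be the conjugation $$\mathcal C_\star h(z)=\frac1{z^{\ell+2}}\,\overline{h(1/\overline z)} .$$ For analytic functions $f:\mathbb H\to\mathbb C$ and $g:\mathbb H\to\mathbb H$, let $W_{f,g,\max}$ be the operator $h\mapsto f\cdot(h\circ g)$ with domain $\{h\in A^2_\ell: f\cdot(h\circ g)\in A^2_\ell\}$. A linear operator $T$ in $A^2_\ell$ is called $\mathcal C_\star$-selfadjoint if it is densely defined and $T=\mathcal C_\star T^*\mathcal C_\star$ (equality of operators, including domains). It is called bounded if its domain is all of $A^2_\ell$ and there is $L>0$ with $\|Th\|\le L\|h\|$ for every $h\in A^2_\ell$. **Theorem.** Let $f:\mathbb H\to\mathbb C$ and $g:\mathbb H\to\mathbb H$ be analytic. Then $W_{f,g,\max}$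 is $\mathcal C_\star$-selfadjoint on $A^2_\ell$ if and only if $f\equiv 0$ or one of the following holds (for all $w\in\mathbb H$): 1. $g(w)=\alpha$ and $f(w)=\dfrac{\beta}{(1+\alpha w)^{\ell+2}}$ for some $\alpha\in\mathbb H$ and $\beta\in\mathbb C$; 2. $g(w)=\lambda w$ and $f(w)=\theta$ for some real $\lambda>0$ and some $\theta\in\mathbb C$; 3. $g(w)=\delta+\dfrac{1-\delta\kappa}{w+\kappa}$ and $f(w)=\dfrac{r}{(w+\kappa)^{\ell+2}}$ for some $\delta,\kappa,r\in\mathbb C$ such that either $\delta\in i\mathbb R$, $\delta\kappa$ is real with $\delta\kappa<1$, and $\operatorname{Re}\kappa\ge 0$; or $$-\operatorname{Re}\delta<0\le\operatorname{Re}\kappa-\frac{\operatorname{Re}(\delta\kappa-1)+|\delta\kappa-1|}{2\operatorname{Re}\delta}.$$ Moreover, if $W_{f,g,\max}$ is $\mathcal C_\star$-selfadjoint, then it is bounded. -/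

import Mathlib

open MeasureTheory Filter Topology
open scoped ENNReal ComplexConjugate LinearPMap

noncomputable section

/-- The open right half-plane. -/
abbrev RightHalfPlane : Type := {z : ℂ // 0 < z.re}

namespace RightHalfPlane

theorem isOpen_setOf : IsOpen {z : ℂ | 0 < z.re} :=
  isOpen_lt continuous_const Complex.continuous_re

theorem measurableSet_setOf : MeasurableSet {z : ℂ | 0 < z.re} :=
  isOpen_setOf.measurableSet

theorem ne_zero (z : RightHalfPlane) : (z : ℂ) ≠ 0 := by
  intro h
  have := z.2
  rw [h] at this
  simp at this

/-- The involution `z ↦ 1 / conj z` of the right half-plane. -/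
def recipConj (z : RightHalfPlane) : RightHalfPlane :=
  ⟨1 / conj (z : ℂ), by
    have h : 0 < Complex.normSq (z : ℂ) := Complex.normSq_pos.2 z.ne_zero
    have : (1 / conj (z : ℂ)).re = (z : ℂ).re / Complex.normSq (z : ℂ) := by
      simp [Complex.inv_re, Complex.normSq_conj]
    rw [this]
    exact div_pos z.2 h⟩

theorem coe_recipConj (z : RightHalfPlane) : (recipConj z : ℂ) = 1 / conj (z : ℂ) := rfl

theorem recipConj_recipConj (z : RightHalfPlane) : recipConj (recipConj z) = z := by
  apply Subtype.ext
  simp [coe_recipConj]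

end RightHalfPlane

/-- Analyticity of a function on the open right half-plane: it is the restriction of a function
on `ℂ` that is analytic at every point of the half-plane. -/
def IsAnalyticOnHalfPlane (h : RightHalfPlane → ℂ) : Prop :=
  ∃ H : ℂ → ℂ, AnalyticOnNhd ℂ H {z : ℂ | 0 < z.re} ∧ ∀ z : RightHalfPlane, h z = H z

/-- The area measure `dx dy` on the right half-plane. -/
def areaMeasure : Measure RightHalfPlane := (volume : Measure ℂ).comap Subtype.val

/-- The measure `(1 / π) x ^ ℓ dx dy` on the right half-plane. -/
def bergmanMeasure (ℓ : ℕ) : Measure RightHalfPlane :=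
  areaMeasure.withDensity
    fun z ↦ ENNReal.ofReal ((z : ℂ).re ^ ℓ / Real.pi)

theorem IsAnalyticOnHalfPlane.continuous {h : RightHalfPlane → ℂ}
    (hh : IsAnalyticOnHalfPlane h) : Continuous h := by
  obtain ⟨H, hH, e⟩ := hh
  have : h = fun z : RightHalfPlane ↦ H z := funext e
  rw [this]
  exact continuousOn_iff_continuous_domRestrict.1 hH.continuousOn

/-- The weighted Bergman space as a subspace of all functions on the right half-plane: analytic
functions `h` with `∫ |h| ^ 2 (1 / π) x ^ ℓ dx dy < ∞`. -/
def bergmanSubmodule (ℓ : ℕ) : Submodule ℂ (RightHalfPlane → ℂ) where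
  carrier := {h | IsAnalyticOnHalfPlane h ∧ MemLp h 2 (bergmanMeasure ℓ)}
  zero_mem' := ⟨⟨0, fun _ _ ↦ analyticAt_const, fun _ ↦ rfl⟩, MemLp.zero'⟩
  add_mem' := by
    rintro a b ⟨⟨A, hA, eA⟩, ha⟩ ⟨⟨B, hB, eB⟩, hb⟩
    exact ⟨⟨A + B, hA.add hB, fun z ↦ by simp [eA, eB]⟩, ha.add hb⟩
  smul_mem' := by
    rintro c a ⟨⟨A, hA, eA⟩, ha⟩
    exact ⟨⟨c • A, fun z hz ↦ analyticAt_const.smul (hA z hz), fun z ↦ by simp [eA]⟩,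
      ha.const_smul c⟩

/-- The weighted Bergman space of the right half-plane. -/
def BergmanSpace (ℓ : ℕ) : Type := bergmanSubmodule ℓ

namespace BergmanSpace

variable {ℓ : ℕ}

instance : AddCommGroup (BergmanSpace ℓ) := inferInstanceAs (AddCommGroup (bergmanSubmodule ℓ))

instance : Module ℂ (BergmanSpace ℓ) := inferInstanceAs (Module ℂ (bergmanSubmodule ℓ))

instance : FunLike (BergmanSpace ℓ) RightHalfPlane ℂ where
  coe h := (show bergmanSubmodule ℓ from h).1
  coe_injective _ _ e := Subtype.ext e

/-- The element of the Bergman space given by a function in `bergmanSubmodule ℓ`. -/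
def ofMem (h : RightHalfPlane → ℂ) (hh : h ∈ bergmanSubmodule ℓ) : BergmanSpace ℓ :=
  show bergmanSubmodule ℓ from ⟨h, hh⟩

theorem coe_ofMem (h : RightHalfPlane → ℂ) (hh : h ∈ bergmanSubmodule ℓ) :
    ⇑(ofMem h hh) = h := rfl

theorem ext {h k : BergmanSpace ℓ} (e : ∀ z, h z = k z) : h = k := DFunLike.ext h k e

theorem mem (h : BergmanSpace ℓ) : ⇑h ∈ bergmanSubmodule ℓ :=
  (show bergmanSubmodule ℓ from h).2

theorem isAnalytic (h : BergmanSpace ℓ) : IsAnalyticOnHalfPlane h := h.mem.1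

theorem memLp (h : BergmanSpace ℓ) : MemLp h 2 (bergmanMeasure ℓ) := h.mem.2

theorem coe_zero (z : RightHalfPlane) : (0 : BergmanSpace ℓ) z = 0 := rfl

theorem coe_add (h k : BergmanSpace ℓ) (z : RightHalfPlane) : (h + k) z = h z + k z := rfl

theorem coe_sub (h k : BergmanSpace ℓ) (z : RightHalfPlane) : (h - k) z = h z - k z := rfl

theorem coe_smul (c : ℂ) (h : BergmanSpace ℓ) (z : RightHalfPlane) : (c • h) z = c * h z := rfl

/-- The embedding into `L²`. -/
def toLp : BergmanSpace ℓ →ₗ[ℂ] Lp ℂ 2 (bergmanMeasure ℓ) where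
  toFun h := h.memLp.toLp h
  map_add' _ _ := rfl
  map_smul' _ _ := rfl

theorem toLp_ae (h : BergmanSpace ℓ) : toLp h =ᵐ[bergmanMeasure ℓ] h := h.memLp.coeFn_toLp

end BergmanSpace

theorem areaMeasure_absolutelyContinuous_bergmanMeasure (ℓ : ℕ) :
    areaMeasure ≪ bergmanMeasure ℓ := by
  apply withDensity_absolutelyContinuous'
  · fun_prop
  · refine Eventually.of_forall fun z ↦ ?_
    have := z.2
    have := Real.pi_pos
    simp only [ne_eq, ENNReal.ofReal_eq_zero, not_le]
    positivity

theorem lintegral_bergmanMeasure (ℓ : ℕ) (F : ℂ → ℝ≥0∞) :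
    ∫⁻ z : RightHalfPlane, F z ∂(bergmanMeasure ℓ) =
      ∫⁻ z in {z : ℂ | 0 < z.re}, ENNReal.ofReal (z.re ^ ℓ / Real.pi) * F z := by
  rw [bergmanMeasure, lintegral_withDensity_eq_lintegral_mul_non_measurable]
  · exact lintegral_subtype_comap RightHalfPlane.measurableSet_setOf
      (fun z : ℂ ↦ ENNReal.ofReal (z.re ^ ℓ / Real.pi) * F z)
  · fun_prop
  · simp

/-- Sub-mean-value property of `|H| ^ 2` on discs. -/
theorem enorm_sq_mul_le_lintegral_ball {H : ℂ → ℂ} {c : ℂ} {r : ℝ} (hr : 0 < r)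
    (hH : DifferentiableOn ℂ H (Metric.ball c r)) :
    ‖H c‖ₑ ^ 2 * ENNReal.ofReal (Real.pi * r ^ 2) ≤ ∫⁻ z in Metric.ball c r, ‖H z‖ₑ ^ 2 := by
  have circ : ∀ ρ ∈ Set.Ioo 0 r, ‖H c‖ₑ ^ 2 * ENNReal.ofReal (2 * Real.pi) ≤
      ∫⁻ θ in Set.Ioo (-Real.pi) Real.pi, ‖H (c + Complex.polarCoord.symm (ρ, θ))‖ₑ ^ 2 := by
    intro ρ hρ
    have hsub : Metric.closedBall c |ρ| ⊆ Metric.ball c r :=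
      Metric.closedBall_subset_ball (by rw [abs_of_pos hρ.1]; exact hρ.2)
    have hd : DifferentiableOn ℂ (fun z ↦ H z ^ 2) (Metric.ball c r) := hH.pow 2
    have mv : Real.circleAverage (fun z ↦ H z ^ 2) c ρ = H c ^ 2 := by
      apply DiffContOnCl.circleAverage
      apply DifferentiableOn.diffContOnCl
      exact hd.mono (Metric.closure_ball_subset_closedBall.trans hsub)
    rw [Real.circleAverage_eq_integral_add (-Real.pi),
      intervalIntegral.integral_comp_add_right (fun θ ↦ H (circleMap c ρ θ) ^ 2)] at mv
    have e1 : (0 : ℝ) + -Real.pi = -Real.pi := by ring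
    have e2 : 2 * Real.pi + -Real.pi = Real.pi := by ring
    rw [e1, e2, intervalIntegral.integral_of_le (by linarith [Real.pi_pos]),
      integral_Ioc_eq_integral_Ioo] at mv
    have e3 : ∀ θ, c + Complex.polarCoord.symm (ρ, θ) = circleMap c ρ θ := by
      intro θ
      rw [Complex.polarCoord_symm_apply, circleMap, Complex.exp_mul_I]
      simp
    simp_rw [e3]
    have e4 : (2 * Real.pi) • H c ^ 2 =
        ∫ θ in Set.Ioo (-Real.pi) Real.pi, H (circleMap c ρ θ) ^ 2 := by
      rw [← mv, smul_inv_smul₀ (by positivity)]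
    calc ‖H c‖ₑ ^ 2 * ENNReal.ofReal (2 * Real.pi) = ‖(2 * Real.pi) • H c ^ 2‖ₑ := by
          rw [enorm_smul, enorm_pow, mul_comm, Real.enorm_of_nonneg (by positivity)]
      _ ≤ ∫⁻ θ in Set.Ioo (-Real.pi) Real.pi, ‖H (circleMap c ρ θ) ^ 2‖ₑ := by
          rw [e4]
          exact enorm_integral_le_lintegral_enorm _
      _ = _ := by simp_rw [enorm_pow]
  have step : ∫⁻ z in Metric.ball c r, ‖H z‖ₑ ^ 2 =
      ∫⁻ p in polarCoord.target, ENNReal.ofReal p.1 •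
        (Metric.ball c r).indicator (fun z ↦ ‖H z‖ₑ ^ 2) (c + Complex.polarCoord.symm p) := by
    rw [Complex.lintegral_comp_polarCoord_symm
      (fun w ↦ (Metric.ball c r).indicator (fun z ↦ ‖H z‖ₑ ^ 2) (c + w)),
      lintegral_add_left_eq_self, lintegral_indicator Metric.isOpen_ball.measurableSet]
  have meas : Measurable ((Metric.ball c r).indicator (fun z ↦ ‖H z‖ₑ ^ 2)) := by
    classical
    rw [← Set.piecewise_eq_indicator]
    exact ContinuousOn.measurable_piecewise
      ((ENNReal.continuous_pow 2).comp_continuousOn hH.continuousOn.enorm)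
      continuousOn_const Metric.isOpen_ball.measurableSet
  have meas2 : Measurable fun p : ℝ × ℝ ↦ ENNReal.ofReal p.1 •
      (Metric.ball c r).indicator (fun z ↦ ‖H z‖ₑ ^ 2) (c + Complex.polarCoord.symm p) := by
    have m1 : Measurable fun p : ℝ × ℝ ↦ c + Complex.polarCoord.symm p := by
      simp_rw [Complex.polarCoord_symm_apply]
      fun_prop
    simp_rw [smul_eq_mul]
    exact measurable_fst.ennreal_ofReal.mul (meas.comp m1)
  rw [step, polarCoord_target, Measure.volume_eq_prod, ← Measure.prod_restrict,
    lintegral_prod _ meas2.aemeasurable]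
  calc ‖H c‖ₑ ^ 2 * ENNReal.ofReal (Real.pi * r ^ 2)
      = ∫⁻ ρ in Set.Ioo 0 r, ENNReal.ofReal ρ * (‖H c‖ₑ ^ 2 * ENNReal.ofReal (2 * Real.pi)) := by
        have hpi := Real.pi_pos
        rw [lintegral_mul_const' _ _ (ENNReal.mul_ne_top (by simp) ENNReal.ofReal_ne_top),
          ← ofReal_integral_eq_lintegral_ofReal, ← integral_Ioc_eq_integral_Ioo,
          ← intervalIntegral.integral_of_le hr.le, integral_id, mul_left_comm,
          ← ENNReal.ofReal_mul (by nlinarith [sq_nonneg r])]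
        · congr 2
          ring
        · exact continuous_id.continuousOn.integrableOn_Icc.mono_set Set.Ioo_subset_Icc_self
        · filter_upwards [self_mem_ae_restrict measurableSet_Ioo] with ρ hρ using hρ.1.le
    _ ≤ ∫⁻ ρ in Set.Ioo 0 r, ∫⁻ θ in Set.Ioo (-Real.pi) Real.pi, ENNReal.ofReal ρ •
          (Metric.ball c r).indicator (fun z ↦ ‖H z‖ₑ ^ 2)
            (c + Complex.polarCoord.symm (ρ, θ)) := by
        refine setLIntegral_mono' measurableSet_Ioo fun ρ hρ ↦ ?_
        have : ∀ θ, c + Complex.polarCoord.symm (ρ, θ) ∈ Metric.ball c r := by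
          intro θ
          rw [Metric.mem_ball, dist_eq_norm, add_sub_cancel_left, Complex.norm_polarCoord_symm,
            abs_of_pos hρ.1]
          exact hρ.2
        simp_rw [Set.indicator_of_mem (this _), smul_eq_mul]
        rw [lintegral_const_mul' _ _ ENNReal.ofReal_ne_top]
        gcongr
        exact circ ρ hρ
    _ ≤ _ := lintegral_mono_set Set.Ioo_subset_Ioi_self

namespace BergmanSpace

variable {ℓ : ℕ}

theorem enorm_sq_toLp (h : BergmanSpace ℓ) :
    ‖toLp h‖ₑ ^ 2 = ∫⁻ z, ‖h z‖ₑ ^ 2 ∂(bergmanMeasure ℓ) := by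
  rw [show toLp h = h.memLp.toLp h from rfl, Lp.enorm_toLp, eLpNorm_eq_lintegral_rpow_enorm_toReal
    (by simp) (by simp), ← ENNReal.rpow_natCast, ← ENNReal.rpow_mul]
  simp

theorem toLp_injective : Function.Injective (toLp (ℓ := ℓ)) := by
  rw [← LinearMap.ker_eq_bot, LinearMap.ker_eq_bot']
  intro h hh
  have h1 : (h : RightHalfPlane → ℂ) =ᵐ[bergmanMeasure ℓ] (0 : RightHalfPlane → ℂ) := by
    refine (toLp_ae h).symm.trans ?_
    rw [hh]
    exact Lp.coeFn_zero _ _ _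
  have h2 := (areaMeasure_absolutelyContinuous_bergmanMeasure ℓ).ae_eq h1
  obtain ⟨H, hH, e⟩ := h.isAnalytic
  have h3 : ∀ᵐ z ∂(volume.restrict {z : ℂ | 0 < z.re}), H z = 0 := by
    have h4 : (fun z : RightHalfPlane ↦ H z) =ᵐ[areaMeasure] (0 : RightHalfPlane → ℂ) := by
      filter_upwards [h2] with z hz
      rw [← e, hz]
    exact (ae_restrict_iff_subtype RightHalfPlane.measurableSet_setOf).2 h4
  have h5 := Measure.eqOn_open_of_ae_eq (f := H) (g := 0) h3 RightHalfPlane.isOpen_setOf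
    hH.continuousOn continuousOn_const
  exact ext fun z ↦ by rw [e, h5 z.2]; rfl

instance : Inner ℂ (BergmanSpace ℓ) := ⟨fun h k ↦ ∫ z, conj (h z) * k z ∂(bergmanMeasure ℓ)⟩

theorem inner_def (h k : BergmanSpace ℓ) :
    inner ℂ h k = ∫ z, conj (h z) * k z ∂(bergmanMeasure ℓ) := rfl

theorem inner_eq_inner_toLp (h k : BergmanSpace ℓ) :
    inner ℂ h k = inner ℂ (toLp h) (toLp k) := by
  rw [inner_def, L2.inner_def]
  refine integral_congr_ae ?_
  filter_upwards [toLp_ae h, toLp_ae k] with z hz kz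
  rw [hz, kz, RCLike.inner_apply, mul_comm]

/-- The inner product `⟨h, k⟩ = (1 / π) ∫ x ^ ℓ conj (h) k dx dy` (linear in the second variable,
which is Mathlib's convention). -/
instance instCore : InnerProductSpace.Core ℂ (BergmanSpace ℓ) where
  conj_inner_symm h k := by simp only [inner_eq_inner_toLp, inner_conj_symm]
  re_inner_nonneg h := by rw [inner_eq_inner_toLp]; exact inner_self_nonneg
  add_left h k l := by simp only [inner_eq_inner_toLp, map_add, inner_add_left]
  smul_left h k c := by simp only [inner_eq_inner_toLp, map_smul, inner_smul_left]
  definite h hh := by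
    rw [inner_eq_inner_toLp, inner_self_eq_zero] at hh
    exact toLp_injective (by simpa using hh)

instance : NormedAddCommGroup (BergmanSpace ℓ) := instCore.toNormedAddCommGroup

instance : InnerProductSpace ℂ (BergmanSpace ℓ) := InnerProductSpace.ofCore instCore.toCore

theorem norm_toLp (h : BergmanSpace ℓ) : ‖toLp h‖ = ‖h‖ := by
  rw [@norm_eq_sqrt_re_inner ℂ, @norm_eq_sqrt_re_inner ℂ, inner_eq_inner_toLp]

theorem enorm_sq_eq (h : BergmanSpace ℓ) :
    ‖h‖ₑ ^ 2 = ∫⁻ z, ‖h z‖ₑ ^ 2 ∂(bergmanMeasure ℓ) := by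
  rw [← enorm_sq_toLp, ← ofReal_norm, ← ofReal_norm, norm_toLp]

theorem norm_sq_eq (h : BergmanSpace ℓ) :
    ‖h‖ ^ 2 = 1 / Real.pi * ∫ z : RightHalfPlane, (z : ℂ).re ^ ℓ * ‖h z‖ ^ 2 ∂areaMeasure := by
  have h0 : ‖h‖ ^ 2 = (inner ℂ h h : ℂ).re := by
    rw [@norm_sq_eq_re_inner ℂ]
    rfl
  have h1 : ∀ z : RightHalfPlane, conj (h z) * h z = ((‖h z‖ ^ 2 : ℝ) : ℂ) := fun z ↦ by
    rw [mul_comm, Complex.mul_conj, Complex.normSq_eq_norm_sq]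
  rw [h0, inner_def]
  simp_rw [h1]
  rw [integral_complex_ofReal, Complex.ofReal_re, bergmanMeasure,
    integral_withDensity_eq_integral_toReal_smul (by fun_prop) (by simp), ← integral_const_mul]
  refine integral_congr_ae (Eventually.of_forall fun z ↦ ?_)
  have := z.2
  have := Real.pi_pos
  simp only [smul_eq_mul]
  rw [ENNReal.toReal_ofReal (by positivity)]
  ring

/-- Point evaluations are bounded. -/
theorem norm_apply_sq_mul_le (h : BergmanSpace ℓ) (z : RightHalfPlane) :
    ‖h z‖ₑ ^ 2 * ENNReal.ofReal (((z : ℂ).re / 2) ^ (ℓ + 2)) ≤ ‖h‖ₑ ^ 2 := by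
  obtain ⟨H, hH, e⟩ := h.isAnalytic
  have hz := z.2
  have hpi := Real.pi_pos
  set r : ℝ := (z : ℂ).re / 2 with hr
  have hr0 : 0 < r := by positivity
  have hball : ∀ w ∈ Metric.ball (z : ℂ) r, r ≤ w.re := by
    intro w hw
    have h1 : |(w - z).re| < r := (Complex.abs_re_le_norm _).trans_lt
      (by simpa [dist_eq_norm] using hw)
    rw [Complex.sub_re, abs_lt] at h1
    linarith [h1.1]
  have hsub : Metric.ball (z : ℂ) r ⊆ {w : ℂ | 0 < w.re} := fun w hw ↦ hr0.trans_le (hball w hw)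
  rw [enorm_sq_eq]
  simp_rw [e]
  rw [lintegral_bergmanMeasure ℓ (fun z ↦ ‖H z‖ₑ ^ 2)]
  calc ‖H z‖ₑ ^ 2 * ENNReal.ofReal (r ^ (ℓ + 2))
      = ENNReal.ofReal (r ^ ℓ / Real.pi) * (‖H z‖ₑ ^ 2 * ENNReal.ofReal (Real.pi * r ^ 2)) := by
        rw [mul_left_comm, ← ENNReal.ofReal_mul (by positivity)]
        congr 2
        field_simp
        ring
    _ ≤ ENNReal.ofReal (r ^ ℓ / Real.pi) * ∫⁻ w in Metric.ball (z : ℂ) r, ‖H w‖ₑ ^ 2 := by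
        gcongr
        exact enorm_sq_mul_le_lintegral_ball hr0 (hH.differentiableOn.mono hsub)
    _ = ∫⁻ w in Metric.ball (z : ℂ) r, ENNReal.ofReal (r ^ ℓ / Real.pi) * ‖H w‖ₑ ^ 2 :=
        (lintegral_const_mul' _ _ ENNReal.ofReal_ne_top).symm
    _ ≤ ∫⁻ w in Metric.ball (z : ℂ) r, ENNReal.ofReal (w.re ^ ℓ / Real.pi) * ‖H w‖ₑ ^ 2 := by
        refine setLIntegral_mono' Metric.isOpen_ball.measurableSet fun w hw ↦ ?_
        have := hball w hw
        gcongr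
    _ ≤ _ := lintegral_mono_set hsub

/-- Point evaluations are uniformly bounded on `{z | ε < re z}`. -/
theorem exists_norm_apply_le (ℓ : ℕ) {ε : ℝ} (hε : 0 < ε) : ∃ K : ℝ, 0 < K ∧
    ∀ (h : BergmanSpace ℓ) (z : RightHalfPlane), ε < (z : ℂ).re → ‖h z‖ ≤ K * ‖h‖ := by
  have hpi := Real.pi_pos
  set a : ℝ := (ε / 2) ^ (ℓ + 2) with ha
  have ha0 : 0 < a := by positivity
  refine ⟨(Real.sqrt a)⁻¹, by positivity, fun h z hz ↦ ?_⟩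
  have h1 : ‖h z‖ₑ ^ 2 * ENNReal.ofReal a ≤ ‖h‖ₑ ^ 2 := by
    refine le_trans ?_ (norm_apply_sq_mul_le h z)
    rw [ha]
    gcongr
  have h2 : ‖h z‖ ^ 2 * a ≤ ‖h‖ ^ 2 := by
    have := ENNReal.toReal_mono (by simp) h1
    simpa [ENNReal.toReal_ofReal ha0.le] using this
  rw [inv_mul_eq_div, le_div_iff₀ (by positivity)]
  refine abs_le_of_sq_le_sq' ?_ (norm_nonneg _) |>.2
  rwa [mul_pow, Real.sq_sqrt ha0.le]

theorem dist_toLp (h k : BergmanSpace ℓ) : dist (toLp h) (toLp k) = dist h k := by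
  rw [dist_eq_norm, dist_eq_norm, ← map_sub, norm_toLp]

instance : CompleteSpace (BergmanSpace ℓ) := by
  refine Metric.complete_of_cauchySeq_tendsto fun u hu ↦ ?_
  have hu' : CauchySeq fun n ↦ toLp (u n) := by
    rw [Metric.cauchySeq_iff] at hu ⊢
    simpa only [dist_toLp] using hu
  obtain ⟨L, hL⟩ := cauchySeq_tendsto_of_complete hu'
  choose U hU eU using fun n ↦ (u n).isAnalytic
  have hunif : ∀ ε : ℝ, 0 < ε → UniformCauchySeqOn U atTop {z : ℂ | ε < z.re} := by
    intro ε hε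
    obtain ⟨K, hK, hb⟩ := exists_norm_apply_le ℓ hε
    rw [Metric.uniformCauchySeqOn_iff]
    intro δ hδ
    obtain ⟨N, hN⟩ := Metric.cauchySeq_iff.1 hu (δ / K) (by positivity)
    refine ⟨N, fun m hm n hn z hz ↦ ?_⟩
    have h1 := hb (u m - u n) ⟨z, hε.trans hz⟩ hz
    have h2 := hN m hm n hn
    rw [coe_sub, eU, eU] at h1
    rw [dist_eq_norm] at h2 ⊢
    refine h1.trans_lt ?_
    rw [lt_div_iff₀ hK] at h2
    linarith
  have hlim : ∀ z : ℂ, ∃ w : ℂ, 0 < z.re → Tendsto (fun n ↦ U n z) atTop (𝓝 w) := by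
    intro z
    by_cases hz : 0 < z.re
    · obtain ⟨w, hw⟩ := cauchySeq_tendsto_of_complete
        ((hunif (z.re / 2) (by positivity)).cauchySeq (x := z) (half_lt_self hz))
      exact ⟨w, fun _ ↦ hw⟩
    · exact ⟨0, fun h ↦ absurd h hz⟩
  choose F hF using hlim
  have hFan : AnalyticOnNhd ℂ F {z : ℂ | 0 < z.re} := by
    refine DifferentiableOn.analyticOnNhd (fun z hz ↦ ?_) RightHalfPlane.isOpen_setOf
    have hz : 0 < z.re := hz
    have hz2 : 0 < z.re / 2 := by positivity
    have ho : IsOpen {w : ℂ | z.re / 2 < w.re} := isOpen_lt continuous_const Complex.continuous_re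
    have hd : DifferentiableOn ℂ F {w : ℂ | z.re / 2 < w.re} :=
      ((hunif _ hz2).tendstoUniformlyOn_of_tendsto
        fun w hw ↦ hF w (hz2.trans hw)).tendstoLocallyUniformlyOn.differentiableOn
        (Eventually.of_forall fun n ↦ (hU n).differentiableOn.mono fun w hw ↦ hz2.trans hw) ho
    exact (hd.differentiableAt (ho.mem_nhds (half_lt_self hz))).differentiableWithinAt
  obtain ⟨ns, hns, hae⟩ := (tendstoInMeasure_of_tendsto_Lp hL).exists_seq_tendsto_ae
  have hFL : (L : RightHalfPlane → ℂ) =ᵐ[bergmanMeasure ℓ] fun z ↦ F z := by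
    have hall : ∀ᵐ z ∂(bergmanMeasure ℓ), ∀ n, toLp (u n) z = u n z :=
      ae_all_iff.2 fun n ↦ toLp_ae (u n)
    filter_upwards [hae, hall] with z h1 h2
    refine tendsto_nhds_unique h1 ?_
    simp_rw [h2, eU]
    exact (hF z z.2).comp hns.tendsto_atTop
  have hmem : (fun z : RightHalfPlane ↦ F z) ∈ bergmanSubmodule ℓ :=
    ⟨⟨F, hFan, fun _ ↦ rfl⟩, (memLp_congr_ae hFL).1 (Lp.memLp L)⟩
  let v : BergmanSpace ℓ := ofMem (fun z ↦ F z) hmem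
  have hv : toLp v = L := Lp.ext ((toLp_ae v).trans hFL.symm)
  refine ⟨v, ?_⟩
  rw [tendsto_iff_dist_tendsto_zero] at hL ⊢
  simpa only [← hv, dist_toLp] using hL

end BergmanSpace

/-! ### Unbounded operators -/

/-- The operator `h ↦ C (A (C h))` with its natural domain `{h | C h ∈ dom A}`, for an anti-linear
map `C`. -/
def conjugateBy {E : Type*} [AddCommGroup E] [Module ℂ E] (C : E →ₗ⋆[ℂ] E) (A : E →ₗ.[ℂ] E) :
    E →ₗ.[ℂ] E where
  domain := A.domain.comap C
  toFun :=
    { toFun := fun h ↦ C (A ⟨C h, h.2⟩)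
      map_add' := fun h k ↦ by
        rw [← map_add, ← LinearPMap.map_add]
        congr 2
        exact Subtype.ext (map_add C _ _)
      map_smul' := fun c h ↦ by
        have : (⟨C (c • h : A.domain.comap C), (c • h).2⟩ : A.domain) =
            conj c • (⟨C h, h.2⟩ : A.domain) := Subtype.ext (by simp)
        rw [this, LinearPMap.map_smul, LinearMap.map_smulₛₗ]
        simp }

/-- `C`-selfadjointness `T = C T* C` of a densely defined operator `T`. -/
def IsCSelfAdjoint {E : Type*} [NormedAddCommGroup E] [InnerProductSpace ℂ E] [CompleteSpace E]
    (C : E →ₗ⋆[ℂ] E) (T : E →ₗ.[ℂ] E) : Prop :=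
  Dense (T.domain : Set E) ∧ T = conjugateBy C T†

/-- An operator is bounded if it is everywhere defined and `‖T h‖ ≤ L ‖h‖` for some `L > 0`. -/
def IsBoundedOperator {E : Type*} [NormedAddCommGroup E] [InnerProductSpace ℂ E]
    (T : E →ₗ.[ℂ] E) : Prop :=
  T.domain = ⊤ ∧ ∃ L : ℝ, 0 < L ∧ ∀ h : T.domain, ‖T h‖ ≤ L * ‖(h : E)‖

/-- The maximal weighted composition operator: `h ↦ f · (h ∘ g)` on the domain of all `h` in the
Bergman space for which `f · (h ∘ g)` is again in the Bergman space. -/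
def maxWeightedComp (ℓ : ℕ) (f : RightHalfPlane → ℂ) (g : RightHalfPlane → RightHalfPlane) :
    BergmanSpace ℓ →ₗ.[ℂ] BergmanSpace ℓ where
  domain :=
    { carrier := {h | (fun z ↦ f z * h (g z)) ∈ bergmanSubmodule ℓ}
      zero_mem' := by
        have : (fun z ↦ f z * (0 : BergmanSpace ℓ) (g z)) = 0 := by
          funext z
          exact mul_zero _
        rw [Set.mem_ofPred_eq, this]
        exact zero_mem _
      add_mem' := fun {a b} ha hb ↦ by
        have : (fun z ↦ f z * (a + b) (g z)) =
            (fun z ↦ f z * a (g z)) + fun z ↦ f z * b (g z) := by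
          funext z
          exact mul_add _ _ _
        rw [Set.mem_ofPred_eq, this]
        exact add_mem ha hb
      smul_mem' := fun c a ha ↦ by
        have : (fun z ↦ f z * (c • a) (g z)) = c • fun z ↦ f z * a (g z) := by
          funext z
          exact mul_left_comm _ _ _
        rw [Set.mem_ofPred_eq, this]
        exact Submodule.smul_mem _ c ha }
  toFun :=
    { toFun := fun h ↦ .ofMem (fun z ↦ f z * h.1 (g z)) h.2
      map_add' := fun h k ↦ BergmanSpace.ext fun z ↦ mul_add _ _ _
      map_smul' := fun c h ↦ BergmanSpace.ext fun z ↦ mul_left_comm _ _ _ }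

theorem maxWeightedComp_apply (ℓ : ℕ) (f : RightHalfPlane → ℂ)
    (g : RightHalfPlane → RightHalfPlane) (h : (maxWeightedComp ℓ f g).domain)
    (z : RightHalfPlane) : maxWeightedComp ℓ f g h z = f z * h.1 (g z) := rfl

/-- The function `z ↦ z ^ (-(ℓ + 2)) conj (h (1 / conj z))`. -/
def cStarFun (ℓ : ℕ) (h : RightHalfPlane → ℂ) (z : RightHalfPlane) : ℂ :=
  1 / (z : ℂ) ^ (ℓ + 2) * conj (h z.recipConj)

theorem cStarFun_isAnalytic (ℓ : ℕ) {h : RightHalfPlane → ℂ} (hh : IsAnalyticOnHalfPlane h) :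
    IsAnalyticOnHalfPlane (cStarFun ℓ h) := by
  obtain ⟨H, hH, e⟩ := hh
  refine ⟨fun z ↦ 1 / z ^ (ℓ + 2) * conj (H (1 / conj z)), ?_, fun z ↦ ?_⟩
  · refine DifferentiableOn.analyticOnNhd ?_ RightHalfPlane.isOpen_setOf
    intro z hz
    have hz0 : z ≠ 0 := RightHalfPlane.ne_zero ⟨z, hz⟩
    refine DifferentiableAt.differentiableWithinAt ?_
    have h1 : DifferentiableAt ℂ H (conj (1 / z)) := by
      have := (RightHalfPlane.recipConj ⟨z, hz⟩).2
      rw [RightHalfPlane.coe_recipConj] at this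
      simpa using (hH _ this).differentiableAt
    have h2 : DifferentiableAt ℂ (conj ∘ H ∘ conj) (1 / z) := by
      simpa using h1.conj_conj
    have h3 : DifferentiableAt ℂ (fun w : ℂ ↦ 1 / w) z := by
      fun_prop (disch := assumption)
    have h4 := h2.comp z h3
    have h5 : DifferentiableAt ℂ (fun w : ℂ ↦ 1 / w ^ (ℓ + 2)) z := by
      fun_prop (disch := simp [hz0])
    refine (h5.mul h4).congr_of_eventuallyEq (Eventually.of_forall fun w ↦ ?_)
    simp
  · simp [cStarFun, e, RightHalfPlane.coe_recipConj]

theorem lintegral_cStarFun (ℓ : ℕ) (h : RightHalfPlane → ℂ) :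
    ∫⁻ z, ‖cStarFun ℓ h z‖ₑ ^ 2 ∂(bergmanMeasure ℓ) = ∫⁻ z, ‖h z‖ₑ ^ 2 ∂(bergmanMeasure ℓ) := by
  set S : Set ℂ := {z : ℂ | 0 < z.re} with hS
  set φ : ℂ → ℂ := EuclideanGeometry.inversion 0 1 with hφ
  have φeq : ∀ z : ℂ, φ z = 1 / conj z := by
    intro z
    rw [hφ, EuclideanGeometry.inversion]
    simp only [dist_zero_right, vsub_eq_sub, sub_zero, vadd_eq_add, add_zero, Complex.real_smul]
    rcases eq_or_ne z 0 with rfl | hz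
    · simp
    · have h1 : (‖z‖ : ℂ) ^ 2 = z * conj z := by
        rw [Complex.mul_conj, Complex.normSq_eq_norm_sq]
        simp
      have h2 : conj z ≠ 0 := by simpa using hz
      push_cast
      rw [div_pow, h1]
      field_simp
  have φmem : ∀ z ∈ S, φ z ∈ S := fun z hz ↦ by
    rw [φeq]
    exact (RightHalfPlane.recipConj ⟨z, hz⟩).2
  have φφ : ∀ z, φ (φ z) = z := fun z ↦ by simp [φeq]
  have φimg : φ '' S = S := by
    apply Set.Subset.antisymm
    · rintro _ ⟨z, hz, rfl⟩
      exact φmem z hz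
    · exact fun z hz ↦ ⟨φ z, φmem z hz, φφ z⟩
  have φinj : Set.InjOn φ S := fun a _ b _ hab ↦ by rw [← φφ a, hab, φφ]
  classical
  let H : ℂ → ℂ := fun z ↦ if hz : 0 < z.re then h ⟨z, hz⟩ else 0
  have hH : ∀ z : RightHalfPlane, h z = H z := fun z ↦ by simp [H, z.2]
  have hL : ∀ z : RightHalfPlane, ‖cStarFun ℓ h z‖ₑ ^ 2 =
      (fun z : ℂ ↦ ‖1 / z ^ (ℓ + 2) * conj (H (φ z))‖ₑ ^ 2) z := fun z ↦ by
    simp only [cStarFun, hH, φeq, RightHalfPlane.coe_recipConj]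
  simp_rw [hL, hH]
  rw [lintegral_bergmanMeasure ℓ (fun z ↦ ‖1 / z ^ (ℓ + 2) * conj (H (φ z))‖ₑ ^ 2),
    lintegral_bergmanMeasure ℓ (fun z ↦ ‖H z‖ₑ ^ 2)]
  conv_rhs => rw [← hS, ← φimg]
  rw [lintegral_image_eq_lintegral_abs_det_fderiv_mul volume RightHalfPlane.measurableSet_setOf
    (f' := fun z ↦ (1 / dist z 0) ^ 2 • ((ℝ ∙ (z - 0))ᗮ.reflection : ℂ →L[ℝ] ℂ))
    (fun z hz ↦ (EuclideanGeometry.hasFDerivAt_inversion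
      (RightHalfPlane.ne_zero ⟨z, hz⟩)).hasFDerivWithinAt) φinj]
  refine setLIntegral_congr_fun RightHalfPlane.measurableSet_setOf fun z hz ↦ ?_
  have hz0 : z ≠ 0 := RightHalfPlane.ne_zero ⟨z, hz⟩
  have hn : 0 < ‖z‖ := norm_pos_iff.2 hz0
  have hz' : 0 < z.re := hz
  have hpi := Real.pi_pos
  have hdet : |((1 / dist z 0) ^ 2 • ((ℝ ∙ (z - 0))ᗮ.reflection : ℂ →L[ℝ] ℂ)).det| =
      (1 / ‖z‖) ^ 4 := by
    have h1 : ((1 / dist z 0) ^ 2 • ((ℝ ∙ (z - 0))ᗮ.reflection : ℂ →L[ℝ] ℂ)).det =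
        ((1 / dist z 0) ^ 2) ^ 2 * LinearMap.det ((ℝ ∙ (z - 0))ᗮ.reflection).toLinearMap := by
      rw [← Complex.finrank_real_complex, ← LinearMap.det_smul]
      rfl
    rw [h1, Submodule.det_reflection, abs_mul, abs_pow, abs_pow, abs_pow, abs_neg, abs_one, one_pow, mul_one,
      dist_zero_right, abs_of_nonneg (by positivity), ← pow_mul]
  have hre : (φ z).re = z.re / ‖z‖ ^ 2 := by
    rw [φeq, one_div, Complex.inv_re, Complex.normSq_conj, Complex.conj_re,
      Complex.normSq_eq_norm_sq]
  have hen : ‖1 / z ^ (ℓ + 2) * conj (H (φ z))‖ₑ ^ 2 =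
      ENNReal.ofReal ((1 / ‖z‖) ^ (2 * (ℓ + 2))) * ‖H (φ z)‖ₑ ^ 2 := by
    rw [enorm_mul, mul_pow, ← ofReal_norm (conj _), RCLike.norm_conj, ofReal_norm]
    congr 1
    rw [← ofReal_norm, ← ENNReal.ofReal_pow (norm_nonneg _), norm_div, norm_pow, norm_one]
    congr 1
    rw [← one_div_pow, ← pow_mul, mul_comm]
  rw [hdet, hre, hen, ← mul_assoc, ← mul_assoc, ← ENNReal.ofReal_mul (by positivity),
    ← ENNReal.ofReal_mul (by positivity)]
  congr 2
  have hpow : ‖z‖ ^ (2 * (ℓ + 2)) = ‖z‖ ^ 4 * (‖z‖ ^ 2) ^ ℓ := by ring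
  rw [one_div_pow, one_div_pow, hpow, div_pow]
  field_simp

theorem cStarFun_mem {ℓ : ℕ} (h : BergmanSpace ℓ) : cStarFun ℓ h ∈ bergmanSubmodule ℓ := by
  refine ⟨cStarFun_isAnalytic ℓ h.isAnalytic,
    (cStarFun_isAnalytic ℓ h.isAnalytic).continuous.aestronglyMeasurable, ?_⟩
  rw [eLpNorm_lt_top_iff_lintegral_rpow_enorm_lt_top (by simp) (by simp)]
  have h1 := lintegral_cStarFun ℓ h
  rw [← BergmanSpace.enorm_sq_eq] at h1
  simp only [ENNReal.toReal_ofNat, ENNReal.rpow_ofNat]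
  rw [h1]
  simp

/-- The anti-linear operator `C_⋆ h (z) = z ^ (-(ℓ + 2)) conj (h (1 / conj z))`. -/
def cStar (ℓ : ℕ) : BergmanSpace ℓ →ₗ⋆[ℂ] BergmanSpace ℓ where
  toFun h := .ofMem (cStarFun ℓ h) (cStarFun_mem h)
  map_add' h k := BergmanSpace.ext fun z ↦ by
    change cStarFun ℓ (fun z ↦ h z + k z) z = cStarFun ℓ h z + cStarFun ℓ k z
    simp [cStarFun, mul_add]
  map_smul' c h := BergmanSpace.ext fun z ↦ by
    change cStarFun ℓ (fun z ↦ c * h z) z = conj c * cStarFun ℓ h z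
    simp [cStarFun]
    ring

/-- `C_⋆` is isometric. Together with `cStar_cStar`: it is a conjugation. -/
theorem norm_cStar {ℓ : ℕ} (h : BergmanSpace ℓ) : ‖cStar ℓ h‖ = ‖h‖ := by
  have h1 : ‖cStar ℓ h‖ₑ ^ 2 = ‖h‖ₑ ^ 2 := by
    rw [BergmanSpace.enorm_sq_eq, BergmanSpace.enorm_sq_eq]
    exact lintegral_cStarFun ℓ h
  have h2 := congrArg ENNReal.toReal h1
  simp only [ENNReal.toReal_pow, toReal_enorm] at h2
  exact (pow_left_inj₀ (norm_nonneg _) (norm_nonneg _) two_ne_zero).1 h2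

theorem cStar_cStar {ℓ : ℕ} (h : BergmanSpace ℓ) : cStar ℓ (cStar ℓ h) = h := by
  refine BergmanSpace.ext fun z ↦ ?_
  change cStarFun ℓ (cStarFun ℓ h) z = h z
  have := z.ne_zero
  simp [cStarFun, RightHalfPlane.recipConj_recipConj, RightHalfPlane.coe_recipConj]
  field_simp

end

noncomputable section

/-! ### Weighted composition with an injective symbol -/

/-! Write n = ℓ + 2 and T for the maximal weighted composition operator. Affine automorphisms of the
half-plane act isometrically up to a scalar weight, and this determines the reproducing kernel up to
a nonzero constant: K_z(w) = c / (w + conj z)^n (`exists_kernel_eq`). Hence C⋆K_z(w) = conj c / (1 +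
zw)^n. If T is densely defined, then T*K_z = conj(f z) K_{g z}, and testing T = C⋆T*C⋆ on C⋆K_z
yields f(w)(1 + g(z)w)^n = f(z)(1 + z g(w))^n (`IsCSelfAdjoint.mul_pow_eq`). Conversely, for bounded
T this identity gives selfadjointness, because kernels reproduce values
(`isCSelfAdjoint_of_mul_pow_eq`).

The identity is solved in `classification_of_mul_pow_eq`. Either f vanishes identically or it
vanishes nowhere; in the second case eliminating f leaves an equality of n-th powers, connectedness
removes the power, and freezing z makes g fractional linear: a constant, a dilation or (1 + δw)/(w +
κ). For the last map, staying in the half-plane forces a discriminant condition on a quadratic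
(`mobius_condition_of_mapsTo`), which `mobius_condition_iff` matches with the stated inequalities.

Every listed pair gives a bounded operator, so selfadjointness implies boundedness. Constant symbols
give rank at most one; the others are injective, and a change of variables applies. In the Möbius
case the weight is controlled by the Schwarz–Pick estimate `re_mul_norm_le_of_mobius_condition`. -/

theorem IsAnalyticOnHalfPlane.mul_comp {f h : RightHalfPlane → ℂ}
    {g : RightHalfPlane → RightHalfPlane} (hf : IsAnalyticOnHalfPlane f)
    (hg : IsAnalyticOnHalfPlane fun z ↦ (g z : ℂ)) (hh : IsAnalyticOnHalfPlane h) :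
    IsAnalyticOnHalfPlane fun z ↦ f z * h (g z) := by
  obtain ⟨F, hF, eF⟩ := hf
  obtain ⟨G, hG, eG⟩ := hg
  obtain ⟨H, hH, eH⟩ := hh
  refine ⟨fun z ↦ F z * H (G z), hF.mul (hH.comp hG fun z hz ↦ ?_), fun z ↦ ?_⟩
  · have := (g ⟨z, hz⟩).2
    simp only [eG] at this
    exact this
  · simp only [eF, eH, eG]

theorem isAnalyticOnHalfPlane_of_differentiableOn {f : RightHalfPlane → ℂ} {F : ℂ → ℂ}
    (hF : DifferentiableOn ℂ F {z : ℂ | 0 < z.re}) (e : ∀ z : RightHalfPlane, f z = F z) :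
    IsAnalyticOnHalfPlane f :=
  ⟨F, hF.analyticOnNhd RightHalfPlane.isOpen_setOf, e⟩

theorem abs_det_smul_one (c : ℂ) : |(c • (1 : ℂ →L[ℝ] ℂ)).det| = ‖c‖ ^ 2 := by
  have h : ((c • (1 : ℂ →L[ℝ] ℂ) : ℂ →L[ℝ] ℂ) : ℂ →ₗ[ℝ] ℂ) =
      ((c • (1 : ℂ →ₗ[ℂ] ℂ)) : ℂ →ₗ[ℂ] ℂ).restrictScalars ℝ := by
    ext
    all_goals simp
  rw [ContinuousLinearMap.det, h, LinearMap.det_restrictScalars]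
  simp [Algebra.norm_complex_apply, Complex.normSq_eq_norm_sq]

/-- Change of variables along an injective holomorphic self-map of the half-plane. -/
theorem setLIntegral_mul_comp_le (ℓ : ℕ) {F G G' : ℂ → ℂ} {M : ℝ} (hM : 0 ≤ M)
    (hG : ∀ z : ℂ, 0 < z.re → HasDerivAt G (G' z) z) (hinj : Set.InjOn G {z : ℂ | 0 < z.re})
    (hmaps : ∀ z : ℂ, 0 < z.re → 0 < (G z).re)
    (hw : ∀ z : ℂ, 0 < z.re → z.re ^ ℓ * ‖F z‖ ^ 2 ≤ M * ((G z).re ^ ℓ * ‖G' z‖ ^ 2))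
    (H : ℂ → ℂ) :
    ∫⁻ z in {z : ℂ | 0 < z.re}, ENNReal.ofReal (z.re ^ ℓ / Real.pi) * ‖F z * H (G z)‖ₑ ^ 2 ≤
      ENNReal.ofReal M *
        ∫⁻ z in {z : ℂ | 0 < z.re}, ENNReal.ofReal (z.re ^ ℓ / Real.pi) * ‖H z‖ₑ ^ 2 := by
  have hpi := Real.pi_pos
  set S : Set ℂ := {z : ℂ | 0 < z.re} with hS
  have hsub : G '' S ⊆ S := by
    rintro _ ⟨z, hz, rfl⟩
    exact hmaps z hz
  calc _ ≤ ∫⁻ z in S, ENNReal.ofReal M * (ENNReal.ofReal |(G' z • (1 : ℂ →L[ℝ] ℂ)).det| *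
          (ENNReal.ofReal ((G z).re ^ ℓ / Real.pi) * ‖H (G z)‖ₑ ^ 2)) := by
        refine setLIntegral_mono' RightHalfPlane.measurableSet_setOf fun z hz ↦ ?_
        have hz' : 0 < z.re := hz
        have hGz := hmaps z hz
        rw [abs_det_smul_one, enorm_mul, mul_pow, ← mul_assoc, ← mul_assoc, ← mul_assoc,
          ← ofReal_norm (F z), ← ENNReal.ofReal_pow (norm_nonneg _),
          ← ENNReal.ofReal_mul (by positivity), ← ENNReal.ofReal_mul hM,
          ← ENNReal.ofReal_mul (by positivity)]
        gcongr ENNReal.ofReal ?_ * _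
        have := hw z hz
        rw [div_mul_eq_mul_div, ← mul_div_assoc, mul_assoc M, mul_comm (‖G' z‖ ^ 2)]
        exact div_le_div_of_nonneg_right this hpi.le
    _ = ENNReal.ofReal M * ∫⁻ z in G '' S, ENNReal.ofReal (z.re ^ ℓ / Real.pi) * ‖H z‖ₑ ^ 2 := by
        rw [lintegral_const_mul' _ _ ENNReal.ofReal_ne_top,
          lintegral_image_eq_lintegral_abs_det_fderiv_mul volume RightHalfPlane.measurableSet_setOf
          (fun z hz ↦ (hG z hz).complexToReal_fderiv.hasFDerivWithinAt) hinj]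
    -- The image of `G` may be a proper subset of the half-plane; enlarging the domain is the only
    -- loss here.
    _ ≤ _ := by gcongr

theorem mem_bergmanSubmodule_of_lintegral_lt_top {ℓ : ℕ} {h : RightHalfPlane → ℂ}
    (hh : IsAnalyticOnHalfPlane h) (hi : ∫⁻ z, ‖h z‖ₑ ^ 2 ∂(bergmanMeasure ℓ) < ∞) :
    h ∈ bergmanSubmodule ℓ := by
  refine ⟨hh, hh.continuous.aestronglyMeasurable, ?_⟩
  rw [eLpNorm_lt_top_iff_lintegral_rpow_enorm_lt_top (by simp) (by simp)]
  simpa only [ENNReal.toReal_ofNat, ENNReal.rpow_ofNat] using hi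

/-- Weighted composition with an injective symbol maps the Bergman space boundedly into itself as
soon as the Jacobian dominates the weight. -/
theorem weightedComp_mem_and_norm_le {ℓ : ℕ} {f : RightHalfPlane → ℂ}
    {g : RightHalfPlane → RightHalfPlane} {F G G' : ℂ → ℂ} {M : ℝ} (hM : 0 ≤ M)
    (hf : IsAnalyticOnHalfPlane f) (eF : ∀ z : RightHalfPlane, f z = F z)
    (eG : ∀ z : RightHalfPlane, (g z : ℂ) = G z)
    (hG : ∀ z : ℂ, 0 < z.re → HasDerivAt G (G' z) z) (hinj : Set.InjOn G {z : ℂ | 0 < z.re})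
    (hw : ∀ z : ℂ, 0 < z.re → z.re ^ ℓ * ‖F z‖ ^ 2 ≤ M * ((G z).re ^ ℓ * ‖G' z‖ ^ 2))
    (h : BergmanSpace ℓ) :
    ∃ hm : (fun z ↦ f z * h (g z)) ∈ bergmanSubmodule ℓ,
      ‖BergmanSpace.ofMem _ hm‖ ≤ Real.sqrt M * ‖h‖ := by
  have hmaps : ∀ z : ℂ, 0 < z.re → 0 < (G z).re := fun z hz ↦ by
    have := (g ⟨z, hz⟩).2
    rwa [eG] at this
  have hg : IsAnalyticOnHalfPlane fun z ↦ (g z : ℂ) :=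
    isAnalyticOnHalfPlane_of_differentiableOn
      (fun z hz ↦ (hG z hz).differentiableAt.differentiableWithinAt) eG
  have key : ∫⁻ z, ‖f z * h (g z)‖ₑ ^ 2 ∂(bergmanMeasure ℓ) ≤ ENNReal.ofReal M * ‖h‖ₑ ^ 2 := by
    obtain ⟨H, hH, eH⟩ := h.isAnalytic
    rw [BergmanSpace.enorm_sq_eq]
    simp_rw [eH, eF, eG]
    rw [lintegral_bergmanMeasure ℓ fun z ↦ ‖F z * H (G z)‖ₑ ^ 2,
      lintegral_bergmanMeasure ℓ fun z ↦ ‖H z‖ₑ ^ 2]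
    exact setLIntegral_mul_comp_le ℓ hM hG hinj hmaps hw H
  have hm := mem_bergmanSubmodule_of_lintegral_lt_top (hf.mul_comp hg h.isAnalytic)
    (key.trans_lt (ENNReal.mul_lt_top ENNReal.ofReal_lt_top (by simp)))
  refine ⟨hm, ?_⟩
  have h1 : ‖BergmanSpace.ofMem _ hm‖ₑ ^ 2 ≤ ENNReal.ofReal M * ‖h‖ₑ ^ 2 := by
    rw [BergmanSpace.enorm_sq_eq]
    exact key
  have h2 := ENNReal.toReal_mono (ENNReal.mul_ne_top ENNReal.ofReal_ne_top (by simp)) h1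
  simp only [ENNReal.toReal_pow, toReal_enorm, ENNReal.toReal_mul, ENNReal.toReal_ofReal hM] at h2
  refine abs_le_of_sq_le_sq' ?_ (by positivity) |>.2
  rwa [mul_pow, Real.sq_sqrt hM]

/-! ### An explicit nonzero element of the Bergman space -/

theorem one_add_normSq_le {z : ℂ} (hz : 0 < z.re) : 1 + ‖z‖ ^ 2 ≤ ‖z + 1‖ ^ 2 := by
  rw [← Complex.normSq_eq_norm_sq, ← Complex.normSq_eq_norm_sq, Complex.normSq_apply,
    Complex.normSq_apply]
  simp
  nlinarith

/-- Being nonzero at `one`, this function later shows that the kernel constant is nonzero. The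
weight is absorbed by |z + 1|^(2ℓ), which leaves |z + 1|^(-4) ≤ 4 (1 + |z|)^(-4), integrable because
4 exceeds the real dimension 2. -/
theorem one_div_add_one_pow_mem (ℓ : ℕ) :
    (fun z : RightHalfPlane ↦ 1 / ((z : ℂ) + 1) ^ (ℓ + 2)) ∈ bergmanSubmodule ℓ := by
  have hne : ∀ z : ℂ, 0 < z.re → z + 1 ≠ 0 := fun z hz h ↦ by
    have := congrArg Complex.re h
    simp at this
    linarith
  refine mem_bergmanSubmodule_of_lintegral_lt_top
    (isAnalyticOnHalfPlane_of_differentiableOn (F := fun z ↦ 1 / (z + 1) ^ (ℓ + 2))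
      (fun z hz ↦ ?_) fun _ ↦ rfl) ?_
  · have := pow_ne_zero (ℓ + 2) (hne z hz)
    exact DifferentiableAt.differentiableWithinAt (by fun_prop (disch := assumption))
  rw [lintegral_bergmanMeasure ℓ fun z ↦ ‖1 / (z + 1) ^ (ℓ + 2)‖ₑ ^ 2]
  have hint : Integrable (fun z : ℂ ↦ (1 + ‖z‖) ^ (-(4 : ℝ))) volume :=
    integrable_one_add_norm (by rw [Complex.finrank_real_complex]; norm_num)
  have hint2 : Integrable (fun z : ℂ ↦ 4 * (1 + ‖z‖) ^ (-(4 : ℝ))) volume := hint.const_mul 4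
  refine lt_of_le_of_lt ?_ (hint2.restrict (s := {z : ℂ | 0 < z.re})).lintegral_lt_top
  refine setLIntegral_mono' RightHalfPlane.measurableSet_setOf fun z hz ↦ ?_
  have hz' : 0 < z.re := hz
  have hpi := Real.pi_gt_three
  have h1 := one_add_normSq_le hz'
  have h2 : z.re ≤ ‖z‖ := Complex.re_le_norm z
  have h3 : 0 < ‖z + 1‖ := norm_pos_iff.2 (hne z hz')
  rw [← ofReal_norm, ← ENNReal.ofReal_pow (norm_nonneg _), ← ENNReal.ofReal_mul (by positivity)]
  apply ENNReal.ofReal_le_ofReal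
  have h4 : (1 + ‖z‖) ^ (-(4 : ℝ)) = 1 / (1 + ‖z‖) ^ 4 := by
    rw [Real.rpow_neg (by positivity), one_div]
    norm_cast
  have h5 : z.re ≤ ‖z + 1‖ ^ 2 := by nlinarith
  rw [h4, norm_div, norm_pow, norm_one, mul_one_div]
  calc z.re ^ ℓ / Real.pi * (1 / ‖z + 1‖ ^ (ℓ + 2)) ^ 2
      ≤ (‖z + 1‖ ^ 2) ^ ℓ / 1 * (1 / ‖z + 1‖ ^ (ℓ + 2)) ^ 2 := by
        gcongr
        linarith
    _ = 1 / (‖z + 1‖ ^ 2) ^ 2 := by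
        field_simp
        ring
    _ ≤ 4 / (1 + ‖z‖) ^ 4 := by
        rw [div_le_div_iff₀ (by positivity) (by positivity)]
        have h6 : (1 + ‖z‖) ^ 2 ≤ 2 * ‖z + 1‖ ^ 2 := by nlinarith [sq_nonneg (1 - ‖z‖)]
        nlinarith [norm_nonneg z]
/-! ### The reproducing kernel -/

namespace RightHalfPlane

/-- The point `1` of the right half-plane. -/
def one : RightHalfPlane := ⟨1, by simp⟩

theorem isPreconnected_setOf : IsPreconnected {z : ℂ | 0 < z.re} :=
  (convex_halfSpace_re_gt 0).isPreconnected

theorem one_add_ne_zero {z : ℂ} (hz : 0 < z.re) : 1 + z ≠ 0 := fun h ↦ by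
  have := congrArg Complex.re h
  simp at this
  linarith

/-- The affine automorphism `z ↦ a z + i t` of the right half-plane. -/
def affine (a t : ℝ) (ha : 0 < a) (z : RightHalfPlane) : RightHalfPlane :=
  ⟨a * z + t * Complex.I, by simpa using mul_pos ha z.2⟩

theorem affine_inv (a t : ℝ) (ha : 0 < a) (z : RightHalfPlane) :
    affine a⁻¹ (-t / a) (inv_pos.2 ha) (affine a t ha z) = z := by
  have : (a : ℂ) ≠ 0 := by exact_mod_cast ha.ne'
  apply Subtype.ext
  simp only [affine]
  push_cast
  field_simp
  ring

end RightHalfPlane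

open RightHalfPlane

namespace BergmanSpace

variable {ℓ : ℕ}

/-- Evaluation at a point as a continuous functional. -/
def evalCLM (ℓ : ℕ) (z : RightHalfPlane) : StrongDual ℂ (BergmanSpace ℓ) :=
  LinearMap.mkContinuousOfExistsBound
    { toFun := fun h ↦ h z
      map_add' := fun h k ↦ coe_add h k z
      map_smul' := fun c h ↦ coe_smul c h z }
    (by
      obtain ⟨K, -, hK⟩ := exists_norm_apply_le ℓ (half_pos z.2)
      exact ⟨K, fun h ↦ hK h z (half_lt_self z.2)⟩)

/-- The reproducing kernel at `z`. -/
def kernel (ℓ : ℕ) (z : RightHalfPlane) : BergmanSpace ℓ :=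
  (InnerProductSpace.toDual ℂ (BergmanSpace ℓ)).symm (evalCLM ℓ z)

theorem inner_kernel (z : RightHalfPlane) (h : BergmanSpace ℓ) :
    inner ℂ (kernel ℓ z) h = h z :=
  InnerProductSpace.toDual_symm_apply

theorem kernel_unique {z : RightHalfPlane} {k : BergmanSpace ℓ}
    (hk : ∀ h : BergmanSpace ℓ, inner ℂ k h = h z) : k = kernel ℓ z :=
  ext_inner_right ℂ fun h ↦ by rw [hk, inner_kernel]

theorem kernel_apply_symm (z w : RightHalfPlane) : kernel ℓ z w = conj (kernel ℓ w z) := by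
  rw [← inner_kernel w (kernel ℓ z), ← inner_kernel z (kernel ℓ w), inner_conj_symm]

/-- The squared factor a^(ℓ + 2) compensates a^ℓ from the weight and a^2 from the area, so the
domination hypothesis holds with equality and M = 1. -/
theorem affine_mem_and_norm_le (a t : ℝ) (ha : 0 < a) (h : BergmanSpace ℓ) :
    ∃ hm : (fun z ↦ ((Real.sqrt a ^ (ℓ + 2) : ℝ) : ℂ) * h (affine a t ha z)) ∈
        bergmanSubmodule ℓ, ‖ofMem _ hm‖ ≤ ‖h‖ := by
  have := weightedComp_mem_and_norm_le (ℓ := ℓ) (M := 1) zero_le_one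
    (f := fun _ ↦ ((Real.sqrt a ^ (ℓ + 2) : ℝ) : ℂ)) (g := affine a t ha)
    (F := fun _ ↦ ((Real.sqrt a ^ (ℓ + 2) : ℝ) : ℂ)) (G := fun z ↦ a * z + t * Complex.I)
    (G' := fun _ ↦ a) ⟨_, fun _ _ ↦ analyticAt_const, fun _ ↦ rfl⟩ (fun _ ↦ rfl) (fun _ ↦ rfl)
    (fun z _ ↦ by simpa using ((hasDerivAt_id z).const_mul (a : ℂ)).add_const (t * Complex.I))
    (fun z _ w _ hzw ↦ by simpa [ha.ne'] using hzw)
    (fun z _ ↦ by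
      rw [Complex.norm_real, Complex.norm_real, Real.norm_of_nonneg (by positivity),
        Real.norm_of_nonneg ha.le, ← pow_mul, mul_comm (ℓ + 2), pow_mul, Real.sq_sqrt ha.le]
      simp
      apply le_of_eq
      ring) h
  simpa using this

/-- The isometry `h ↦ a ^ ((ℓ + 2) / 2) h (a z + i t)`. -/
def affineComp (ℓ : ℕ) (a t : ℝ) (ha : 0 < a) : BergmanSpace ℓ →ₗ[ℂ] BergmanSpace ℓ where
  toFun h := ofMem _ (affine_mem_and_norm_le a t ha h).1
  map_add' _ _ := ext fun _ ↦ mul_add _ _ _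
  map_smul' _ _ := ext fun _ ↦ mul_left_comm _ _ _

theorem affineComp_apply (a t : ℝ) (ha : 0 < a) (h : BergmanSpace ℓ) (z : RightHalfPlane) :
    affineComp ℓ a t ha h z = ((Real.sqrt a ^ (ℓ + 2) : ℝ) : ℂ) * h (affine a t ha z) := rfl

theorem affineComp_inv (a t : ℝ) (ha : 0 < a) (h : BergmanSpace ℓ) :
    affineComp ℓ a t ha (affineComp ℓ a⁻¹ (-t / a) (inv_pos.2 ha) h) = h := by
  refine ext fun z ↦ ?_
  rw [affineComp_apply, affineComp_apply, affine_inv, ← mul_assoc, ← Complex.ofReal_mul,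
    ← mul_pow, ← Real.sqrt_mul ha.le, mul_inv_cancel₀ ha.ne']
  simp

theorem affineComp_inv' (a t : ℝ) (ha : 0 < a) (h : BergmanSpace ℓ) :
    affineComp ℓ a⁻¹ (-t / a) (inv_pos.2 ha) (affineComp ℓ a t ha h) = h := by
  have := affineComp_inv a⁻¹ (-t / a) (inv_pos.2 ha) h
  have e : -(-t / a) / a⁻¹ = t := by
    field_simp
  simpa only [inv_inv, e] using this

/-- A contraction with a contractive inverse of the same kind is isometric. -/
theorem norm_affineComp (a t : ℝ) (ha : 0 < a) (h : BergmanSpace ℓ) :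
    ‖affineComp ℓ a t ha h‖ = ‖h‖ := by
  refine le_antisymm (affine_mem_and_norm_le a t ha h).2 ?_
  have := (affine_mem_and_norm_le a⁻¹ (-t / a) (inv_pos.2 ha) (affineComp ℓ a t ha h)).2
  change ‖affineComp ℓ a⁻¹ (-t / a) (inv_pos.2 ha) (affineComp ℓ a t ha h)‖ ≤ _ at this
  rwa [affineComp_inv'] at this

theorem inner_affineComp (a t : ℝ) (ha : 0 < a) (h k : BergmanSpace ℓ) :
    inner ℂ (affineComp ℓ a t ha h) (affineComp ℓ a t ha k) = inner ℂ h k :=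
  LinearIsometry.inner_map_map ⟨affineComp ℓ a t ha, norm_affineComp a t ha⟩ h k

/-- The inverse of an isometry is its adjoint, so it carries the kernel at `one` to a multiple of
the kernel at the image point. Every point is an affine image of `one`, hence a single kernel
determines all of them. -/
theorem kernel_affine_one (a t : ℝ) (ha : 0 < a) (w : RightHalfPlane) :
    kernel ℓ (affine a t ha one) w =
      kernel ℓ one (affine a⁻¹ (-t / a) (inv_pos.2 ha) w) / (a : ℂ) ^ (ℓ + 2) := by
  have hs : 0 < Real.sqrt a ^ (ℓ + 2) := by positivity
  have hs' : ((Real.sqrt a ^ (ℓ + 2) : ℝ) : ℂ) ≠ 0 := by exact_mod_cast hs.ne'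
  have h1 : ((Real.sqrt a ^ (ℓ + 2) : ℝ) : ℂ)⁻¹ •
      affineComp ℓ a⁻¹ (-t / a) (inv_pos.2 ha) (kernel ℓ one) = kernel ℓ (affine a t ha one) := by
    refine kernel_unique fun h ↦ ?_
    rw [inner_smul_left, ← inner_affineComp a t ha, affineComp_inv, inner_kernel, affineComp_apply,
      map_inv₀, Complex.conj_ofReal, inv_mul_cancel_left₀ hs']
  rw [← h1, coe_smul, affineComp_apply, ← mul_assoc, div_eq_mul_inv _ ((a : ℂ) ^ (ℓ + 2)),
    mul_comm (kernel ℓ one _)]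
  congr 1
  have h2 : Real.sqrt a ^ (ℓ + 2) * Real.sqrt a ^ (ℓ + 2) = a ^ (ℓ + 2) := by
    rw [← mul_pow, Real.mul_self_sqrt ha.le]
  have h3 : (a : ℂ) ^ (ℓ + 2) =
      ((Real.sqrt a ^ (ℓ + 2) : ℝ) : ℂ) * ((Real.sqrt a ^ (ℓ + 2) : ℝ) : ℂ) := by
    rw [← Complex.ofReal_mul, h2, Complex.ofReal_pow]
  rw [h3, Real.sqrt_inv, inv_pow, Complex.ofReal_inv, mul_inv]

/-- The first-order equation of the kernel at `1`, from the Cauchy–Riemann equations in the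
other variable. -/
theorem one_add_mul_deriv_kernel_one {k : ℂ → ℂ} (hk : AnalyticOnNhd ℂ k {z : ℂ | 0 < z.re})
    (ek : ∀ z : RightHalfPlane, kernel ℓ one z = k z) (w : RightHalfPlane) :
    (1 + (w : ℂ)) * deriv k w = -(ℓ + 2 : ℕ) * k w := by
  obtain ⟨P, hP, eP⟩ := (kernel ℓ w).isAnalytic
  have hP1 : HasDerivAt P (deriv P 1) 1 := (hP 1 (by simp)).differentiableAt.hasDerivAt
  have hkw : HasDerivAt k (deriv k w) w := (hk w w.2).differentiableAt.hasDerivAt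
  -- Both sides are the value at `w` of the kernel at a + it: the left by conjugate symmetry, the
  -- right by affine transport. Differentiating in a and in t at (1, 0) gives two expressions for
  -- conj P'(1).
  have eq : ∀ (a t : ℝ), 0 < a → conj (P (a + t * Complex.I)) =
      k (((w : ℂ) - t * Complex.I) / a) / (a : ℂ) ^ (ℓ + 2) := fun a t ha ↦ by
    have ha' : (a : ℂ) ≠ 0 := by exact_mod_cast ha.ne'
    have h1 := kernel_affine_one (ℓ := ℓ) a t ha w
    rw [kernel_apply_symm, eP, ek] at h1
    simp only [affine, one, mul_one] at h1
    rw [h1]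
    congr 2
    push_cast
    field_simp
    ring
  have c1 : HasDerivAt (fun s : ℝ ↦ conj (P (s + (0 : ℝ) * Complex.I))) (conj (deriv P 1)) 1 := by
    have h1 : HasDerivAt (fun s : ℝ ↦ P s) (deriv P 1) 1 :=
      HasDerivAt.comp_ofReal (z := 1) (by simpa using hP1)
    have := Complex.conjCLE.hasFDerivAt.comp_hasDerivAt (1 : ℝ) h1
    simpa [Function.comp_def] using this
  have c2 : HasDerivAt (fun s : ℝ ↦ conj (P ((1 : ℝ) + s * Complex.I)))
      (conj (deriv P 1 * Complex.I)) 0 := by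
    have h0 : HasDerivAt (fun z : ℂ ↦ (1 : ℂ) + z * Complex.I) Complex.I 0 := by
      simpa using ((hasDerivAt_id (0 : ℂ)).mul_const Complex.I).const_add 1
    have h1 : HasDerivAt (fun z : ℂ ↦ P (1 + z * Complex.I)) (deriv P 1 * Complex.I) 0 :=
      HasDerivAt.comp (h₂ := P) 0 (by simpa using hP1) h0
    have h2 : HasDerivAt (fun s : ℝ ↦ P (1 + s * Complex.I)) (deriv P 1 * Complex.I) 0 :=
      HasDerivAt.comp_ofReal (e := fun z : ℂ ↦ P (1 + z * Complex.I)) (z := 0) (by simpa using h1)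
    have := Complex.conjCLE.hasFDerivAt.comp_hasDerivAt (0 : ℝ) h2
    simpa [Function.comp_def] using this
  have d1 : HasDerivAt (fun s : ℝ ↦ k (((w : ℂ) - (0 : ℝ) * Complex.I) / s) / (s : ℂ) ^ (ℓ + 2))
      (-(w * deriv k w) - (ℓ + 2 : ℕ) * k w) 1 := by
    have h0 : HasDerivAt (fun z : ℂ ↦ (w : ℂ) / z) (-w) 1 := by
      simpa [div_eq_mul_inv] using (hasDerivAt_inv (one_ne_zero (α := ℂ))).const_mul (w : ℂ)
    have h1 : HasDerivAt (fun z : ℂ ↦ k (w / z)) (deriv k w * -w) 1 :=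
      HasDerivAt.comp (h₂ := k) 1 (by simpa using hkw) h0
    have h2 := h1.div (hasDerivAt_pow (ℓ + 2) (1 : ℂ)) (by simp)
    have h3 := HasDerivAt.comp_ofReal (z := 1) (by simpa using h2)
    have e : -(w * deriv k w) - (ℓ + 2 : ℕ) * k w =
      -(deriv k w * w) - k w * (ℓ + 2) := by push_cast; ring
    rw [e]
    simpa using h3
  have d2 : HasDerivAt (fun s : ℝ ↦
      k (((w : ℂ) - s * Complex.I) / (1 : ℝ)) / ((1 : ℝ) : ℂ) ^ (ℓ + 2))
      (deriv k w * -Complex.I) 0 := by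
    have h0 : HasDerivAt (fun z : ℂ ↦ (w : ℂ) - z * Complex.I) (-Complex.I) 0 := by
      simpa using ((hasDerivAt_id (0 : ℂ)).mul_const Complex.I).const_sub (w : ℂ)
    have h1 : HasDerivAt (fun z : ℂ ↦ k (w - z * Complex.I)) (deriv k w * -Complex.I) 0 :=
      HasDerivAt.comp (h₂ := k) 0 (by simpa using hkw) h0
    have h2 : HasDerivAt (fun s : ℝ ↦ k (w - s * Complex.I)) (deriv k w * -Complex.I) 0 :=
      HasDerivAt.comp_ofReal (e := fun z : ℂ ↦ k (w - z * Complex.I)) (z := 0)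
        (by simpa using h1)
    simpa using h2
  have e1 := c1.unique (d1.congr_of_eventuallyEq (by
    filter_upwards [lt_mem_nhds (zero_lt_one (α := ℝ))] with s hs using eq s 0 hs))
  have e2 := c2.unique (d2.congr_of_eventuallyEq
    (Eventually.of_forall fun s ↦ eq 1 s one_pos))
  rw [map_mul, Complex.conj_I, e1] at e2
  have e3 := mul_right_cancel₀ (neg_ne_zero.2 Complex.I_ne_zero) e2
  linear_combination -e3

/-- The first-order equation makes (1 + w)^(ℓ + 2) k(w) constant, and affine transport moves the
formula from `one` to every z. The value of c is never needed; if c were zero, all functions in the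
space would vanish at `one`. -/
theorem exists_kernel_eq (ℓ : ℕ) : ∃ c : ℂ, c ≠ 0 ∧ ∀ z w : RightHalfPlane,
    kernel ℓ z w = c / ((w : ℂ) + conj (z : ℂ)) ^ (ℓ + 2) := by
  obtain ⟨k, hk, ek⟩ := (kernel ℓ one).isAnalytic
  have hd : ∀ z : ℂ, 0 < z.re → HasDerivAt (fun w ↦ (1 + w) ^ (ℓ + 2) * k w) 0 z := fun z hz ↦ by
    have h1 := one_add_mul_deriv_kernel_one hk ek ⟨z, hz⟩
    have h2 : HasDerivAt (fun w : ℂ ↦ (1 + w) ^ (ℓ + 2)) ((ℓ + 2 : ℕ) * (1 + z) ^ (ℓ + 1)) z := by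
      simpa using ((hasDerivAt_id z).const_add 1).fun_pow (ℓ + 2)
    have h3 := h2.mul (hk z hz).differentiableAt.hasDerivAt
    have e : (ℓ + 2 : ℕ) * (1 + z) ^ (ℓ + 1) * k z + (1 + z) ^ (ℓ + 2) * deriv k z = 0 := by
      rw [pow_succ _ (ℓ + 1)]
      linear_combination (1 + z) ^ (ℓ + 1) * h1
    rwa [e] at h3
  have hc : ∀ z : ℂ, 0 < z.re → (1 + z) ^ (ℓ + 2) * k z = (1 + 1) ^ (ℓ + 2) * k 1 := fun z hz ↦
    isOpen_setOf.is_const_of_deriv_eq_zero isPreconnected_setOf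
      (fun w hw ↦ (hd w hw).differentiableAt.differentiableWithinAt)
      (fun w hw ↦ (hd w hw).deriv) (x := z) (y := 1) hz (by simp)
  set c := (1 + 1) ^ (ℓ + 2) * k 1 with hcdef
  have hkc : ∀ z : RightHalfPlane, kernel ℓ one z = c / (1 + (z : ℂ)) ^ (ℓ + 2) := fun z ↦ by
    rw [ek, eq_div_iff (pow_ne_zero _ (one_add_ne_zero z.2)), mul_comm]
    exact hc z z.2
  refine ⟨c, fun h0 ↦ ?_, fun z w ↦ ?_⟩
  · have hz : kernel ℓ one = 0 := ext fun z ↦ by rw [hkc, h0, zero_div, coe_zero]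
    have h1 := inner_kernel one (ofMem _ (one_div_add_one_pow_mem ℓ))
    rw [hz, inner_zero_left, coe_ofMem] at h1
    simp [one] at h1
    rw [one_add_one_eq_two] at h1
    exact pow_ne_zero _ two_ne_zero h1.symm
  · have hz := z.2
    have ha' : ((z : ℂ).re : ℂ) ≠ 0 := by exact_mod_cast hz.ne'
    have e : z = affine (z : ℂ).re (z : ℂ).im hz one := by
      apply Subtype.ext
      simp [affine, one]
    conv_lhs => rw [e]
    rw [kernel_affine_one, hkc, div_div, ← mul_pow]
    congr 2
    simp only [affine]
    push_cast
    have e2 : conj (z : ℂ) = (z : ℂ).re - (z : ℂ).im * Complex.I :=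
      Complex.ext (by simp) (by simp)
    rw [e2]
    field_simp
    ring

end BergmanSpace

/-! ### The action of the conjugation on kernels -/

namespace RightHalfPlane

/-- Otherwise z = -1/w, whose real part is not positive. -/
theorem one_add_mul_ne_zero (z w : RightHalfPlane) : 1 + (z : ℂ) * w ≠ 0 := fun h ↦ by
  have hz := z.2
  have h1 : (z : ℂ) = -(w : ℂ)⁻¹ := by
    field_simp [w.ne_zero]
    linear_combination h
  have h2 : 0 ≤ ((w : ℂ)⁻¹).re := by
    rw [Complex.inv_re]
    exact div_nonneg w.2.le (Complex.normSq_nonneg _)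
  rw [h1, Complex.neg_re] at hz
  linarith

end RightHalfPlane

theorem cStar_apply {ℓ : ℕ} (h : BergmanSpace ℓ) (z : RightHalfPlane) :
    cStar ℓ h z = 1 / (z : ℂ) ^ (ℓ + 2) * conj (h z.recipConj) := rfl

/-- The factor w^(ℓ + 2) merges with (1/w + z)^(ℓ + 2). The result is symmetric in z and w, which is
why selfadjointness becomes a symmetric identity. -/
theorem cStar_kernel_apply {ℓ : ℕ} {c : ℂ} (hc : ∀ z w : RightHalfPlane,
    BergmanSpace.kernel ℓ z w = c / ((w : ℂ) + conj (z : ℂ)) ^ (ℓ + 2)) (z w : RightHalfPlane) :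
    cStar ℓ (BergmanSpace.kernel ℓ z) w = conj c / (1 + (z : ℂ) * w) ^ (ℓ + 2) := by
  have hw := w.ne_zero
  have e : 1 + (z : ℂ) * w = w * (1 / w + z) := by
    field_simp
  rw [cStar_apply, hc, e, mul_pow]
  simp only [coe_recipConj, map_div₀, map_pow, map_add, map_one, Complex.conj_conj]
  rw [one_div_mul_eq_div, div_div, mul_comm]

/-- Polarization: each of the four combinations is, up to a unimodular factor, the image of one with
the arguments exchanged, antilinearity accounting for the signs of I. -/
theorem inner_cStar {ℓ : ℕ} (h k : BergmanSpace ℓ) :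
    inner ℂ (cStar ℓ h) (cStar ℓ k) = inner ℂ k h := by
  have e1 : cStar ℓ h + cStar ℓ k = cStar ℓ (k + h) := by rw [map_add, add_comm]
  have e2 : cStar ℓ h - cStar ℓ k = -cStar ℓ (k - h) := by rw [map_sub, neg_sub]
  have e3 : cStar ℓ h - Complex.I • cStar ℓ k = -Complex.I • cStar ℓ (k - Complex.I • h) := by
    rw [map_sub, LinearMap.map_smulₛₗ, smul_sub, smul_smul]
    simp
    abel
  have e4 : cStar ℓ h + Complex.I • cStar ℓ k = Complex.I • cStar ℓ (k + Complex.I • h) := by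
    rw [map_add, LinearMap.map_smulₛₗ, smul_add, smul_smul]
    simp
    abel
  rw [inner_eq_sum_norm_sq_div_four, inner_eq_sum_norm_sq_div_four k h]
  simp only [RCLike.I_to_complex]
  rw [e1, e2, e3, e4, norm_neg, norm_smul, norm_smul, norm_cStar, norm_cStar, norm_cStar,
    norm_cStar]
  simp

/-! ### The kernel identity -/

theorem LinearPMap.exists_apply_eq_of_eq {E : Type*} [AddCommGroup E] [Module ℂ E]
    {S T : E →ₗ.[ℂ] E} (e : S = T) {x : E} (hx : x ∈ T.domain) :
    ∃ hx' : x ∈ S.domain, S ⟨x, hx'⟩ = T ⟨x, hx⟩ := by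
  subst e
  exact ⟨hx, rfl⟩

open BergmanSpace in
-- The reproducing property alone puts every kernel in the domain of the adjoint, without any
-- boundedness; density makes the adjoint value unique. So the conjugated kernel lies in the domain
-- of T, and its image is evaluated at w in two ways.
theorem IsCSelfAdjoint.mul_pow_eq {ℓ : ℕ} {f : RightHalfPlane → ℂ}
    {g : RightHalfPlane → RightHalfPlane}
    (hT : IsCSelfAdjoint (cStar ℓ) (maxWeightedComp ℓ f g)) (z w : RightHalfPlane) :
    f w * (1 + (g z : ℂ) * w) ^ (ℓ + 2) = f z * (1 + (z : ℂ) * g w) ^ (ℓ + 2) := by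
  obtain ⟨hd, he⟩ := hT
  obtain ⟨c, hc0, hc⟩ := exists_kernel_eq ℓ
  have h1 : ∀ h : (maxWeightedComp ℓ f g).domain,
      inner ℂ (conj (f z) • kernel ℓ (g z)) (h : BergmanSpace ℓ) =
        inner ℂ (kernel ℓ z) (maxWeightedComp ℓ f g h) := fun h ↦ by
    rw [inner_smul_left, inner_kernel, inner_kernel, maxWeightedComp_apply, Complex.conj_conj]
  have h2 : kernel ℓ z ∈ (maxWeightedComp ℓ f g)†.domain :=
    LinearPMap.mem_adjoint_domain_of_exists _ ⟨_, h1⟩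
  have h3 : cStar ℓ (cStar ℓ (kernel ℓ z)) ∈ (maxWeightedComp ℓ f g)†.domain := by
    rwa [cStar_cStar]
  obtain ⟨h4, h5⟩ := LinearPMap.exists_apply_eq_of_eq he (x := cStar ℓ (kernel ℓ z)) h3
  have h6 : (maxWeightedComp ℓ f g)† ⟨_, h3⟩ = conj (f z) • kernel ℓ (g z) :=
    LinearPMap.adjoint_apply_eq hd _ fun h ↦ by simpa only [cStar_cStar] using h1 h
  change _ = cStar ℓ ((maxWeightedComp ℓ f g)† ⟨_, h3⟩) at h5
  rw [h6, LinearMap.map_smulₛₗ] at h5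
  have h7 := DFunLike.congr_fun h5 w
  rw [maxWeightedComp_apply, coe_smul, cStar_kernel_apply hc, cStar_kernel_apply hc] at h7
  have n1 := pow_ne_zero (ℓ + 2) (one_add_mul_ne_zero z (g w))
  have n2 := pow_ne_zero (ℓ + 2) (one_add_mul_ne_zero (g z) w)
  have n3 : conj c ≠ 0 := by simpa using hc0
  simp only [Complex.conj_conj] at h7
  field_simp at h7
  rw [h7, mul_comm]

/-! ### From the kernel identity back to selfadjointness -/

theorem isBoundedOperator_maxWeightedComp {ℓ : ℕ} {f : RightHalfPlane → ℂ}
    {g : RightHalfPlane → RightHalfPlane} {L : ℝ}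
    (hb : ∀ h : BergmanSpace ℓ, ∃ hm : (fun z ↦ f z * h (g z)) ∈ bergmanSubmodule ℓ,
      ‖BergmanSpace.ofMem _ hm‖ ≤ L * ‖h‖) :
    IsBoundedOperator (maxWeightedComp ℓ f g) := by
  -- The definition wants a strictly positive constant, while `L` may be zero.
  refine ⟨eq_top_iff.2 fun h _ ↦ (hb h).1, |L| + 1, by positivity, fun h ↦ ?_⟩
  refine ((hb h).2.trans ?_ : ‖maxWeightedComp ℓ f g h‖ ≤ _)
  gcongr
  linarith [le_abs_self L]

open BergmanSpace in
-- Boundedness makes both domains the whole space, so only values remain. The value of C⋆T*C⋆h at z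
-- is ⟨T*C⋆h, C⋆K_z⟩ = ⟨C⋆h, T C⋆K_z⟩, and the identity evaluates T C⋆K_z.
theorem isCSelfAdjoint_of_mul_pow_eq {ℓ : ℕ} {f : RightHalfPlane → ℂ}
    {g : RightHalfPlane → RightHalfPlane} (hb : IsBoundedOperator (maxWeightedComp ℓ f g))
    (hs : ∀ z w : RightHalfPlane,
      f w * (1 + (g z : ℂ) * w) ^ (ℓ + 2) = f z * (1 + (z : ℂ) * g w) ^ (ℓ + 2)) :
    IsCSelfAdjoint (cStar ℓ) (maxWeightedComp ℓ f g) := by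
  obtain ⟨hdom, L, -, hL⟩ := hb
  obtain ⟨c, hc0, hc⟩ := exists_kernel_eq ℓ
  have hmem : ∀ h, h ∈ (maxWeightedComp ℓ f g).domain := fun h ↦ hdom ▸ Submodule.mem_top
  have hd : Dense ((maxWeightedComp ℓ f g).domain : Set (BergmanSpace ℓ)) := by
    rw [hdom]
    exact dense_univ
  have hadj : ∀ h, h ∈ (maxWeightedComp ℓ f g)†.domain := fun h ↦ by
    rw [LinearPMap.mem_adjoint_domain_iff]
    refine AddMonoidHomClass.continuous_of_bound _ (‖h‖ * L) fun x ↦ ?_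
    rw [mul_assoc]
    exact (norm_inner_le_norm _ _).trans (mul_le_mul_of_nonneg_left (hL x) (norm_nonneg _))
  refine ⟨hd, LinearPMap.ext ?_ fun h hh hh' ↦ ?_⟩
  · rw [hdom]
    exact (eq_top_iff.2 fun h _ ↦ hadj _).symm
  refine BergmanSpace.ext fun z ↦ ?_
  change _ = cStar ℓ ((maxWeightedComp ℓ f g)† ⟨cStar ℓ h, hh'⟩) z
  have hk : maxWeightedComp ℓ f g ⟨cStar ℓ (kernel ℓ z), hmem _⟩ =
      f z • cStar ℓ (kernel ℓ (g z)) := by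
    refine BergmanSpace.ext fun w ↦ ?_
    rw [maxWeightedComp_apply, coe_smul, cStar_kernel_apply hc, cStar_kernel_apply hc]
    have n1 := pow_ne_zero (ℓ + 2) (one_add_mul_ne_zero z (g w))
    have n2 := pow_ne_zero (ℓ + 2) (one_add_mul_ne_zero (g z) w)
    have := hs z w
    field_simp
    linear_combination conj c * this
  rw [maxWeightedComp_apply, ← inner_kernel z (cStar ℓ _)]
  conv_rhs => rw [← cStar_cStar (kernel ℓ z)]
  rw [inner_cStar,
    LinearPMap.adjoint_isFormalAdjoint hd ⟨cStar ℓ h, hh'⟩ ⟨cStar ℓ (kernel ℓ z), hmem _⟩, hk,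
    inner_smul_right, inner_cStar, inner_kernel]

/-! ### Möbius self-maps of the half-plane -/

/-- The condition on `δ, κ` for `w ↦ δ + (1 - δ κ) / (w + κ)` to map the half-plane into itself,
in a form that is uniform in `re δ ≥ 0`. -/
theorem mobius_condition_iff (δ κ : ℂ) :
    ((δ.re = 0 ∧ (δ * κ).im = 0 ∧ (δ * κ).re < 1 ∧ 0 ≤ κ.re) ∨
      (-δ.re < 0 ∧ 0 ≤ κ.re - ((δ * κ - 1).re + ‖δ * κ - 1‖) / (2 * δ.re))) ↔
    0 ≤ δ.re ∧ 0 ≤ κ.re ∧ ‖1 - δ * κ‖ ≤ 1 + δ.re * κ.re + δ.im * κ.im ∧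
      (δ.re = 0 → 1 - δ * κ ≠ 0) := by
  -- With A = 1 + re δ re κ + im δ im κ and B = im δ re κ - re δ im κ, the norm bound is, once A ≥
  -- 0, the discriminant condition B^2 ≤ 4 re δ re κ.
  have hn : ‖1 - δ * κ‖ ^ 2 = (1 + δ.re * κ.re + δ.im * κ.im) ^ 2 - 4 * (δ.re * κ.re) +
      (δ.im * κ.re - δ.re * κ.im) ^ 2 := by
    rw [← Complex.normSq_eq_norm_sq, Complex.normSq_apply]
    simp
    ring
  have h0 := norm_nonneg (1 - δ * κ)
  rw [norm_sub_rev (δ * κ) 1]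
  have hre : (δ * κ - 1).re = δ.re * κ.re - δ.im * κ.im - 1 := by simp
  have him : (δ * κ).im = δ.re * κ.im + δ.im * κ.re := by simp
  have hre' : (δ * κ).re = δ.re * κ.re - δ.im * κ.im := by simp
  rw [hre, him, hre']
  constructor
  · rintro (⟨h1, h2, h3, h4⟩ | ⟨h1, h2⟩)
    · rw [h1] at hn h2 h3 ⊢
      have h5 : δ.im * κ.re = 0 := by linarith
      refine ⟨le_rfl, h4, ?_, fun _ h ↦ ?_⟩
      · refine abs_le_of_sq_le_sq' ?_ (by linarith) |>.2
        rw [hn]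
        nlinarith
      · have := congrArg Complex.re h
        simp [h1] at this
        linarith
    · have hd : 0 < δ.re := by linarith
      rw [sub_nonneg, div_le_iff₀ (by positivity)] at h2
      refine ⟨hd.le, ?_, by linarith, fun h ↦ absurd h hd.ne'⟩
      -- The second alternative does not state re κ ≥ 0; it follows from re (1 - δκ) ≤ |1 - δκ| and
      -- re δ > 0.
      have h4 : (1 - δ * κ).re ≤ ‖1 - δ * κ‖ := Complex.re_le_norm _
      have h5 : (1 - δ * κ).re = 1 - (δ.re * κ.re - δ.im * κ.im) := by simp
      have h6 : 0 ≤ κ.re * δ.re := by linarith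
      exact nonneg_of_mul_nonneg_left h6 hd
  · rintro ⟨h1, h2, h3, h4⟩
    rcases h1.eq_or_lt with h1 | h1
    · left
      rw [← h1] at hn h3 ⊢
      have h5 : ‖1 - δ * κ‖ ≠ 0 := norm_ne_zero_iff.2 (h4 h1.symm)
      have h6 : 0 < ‖1 - δ * κ‖ := lt_of_le_of_ne h0 h5.symm
      have h7 : δ.im * κ.re = 0 := by
        have : (δ.im * κ.re) ^ 2 ≤ 0 := by nlinarith
        exact pow_eq_zero_iff two_ne_zero |>.1 (le_antisymm this (sq_nonneg _))
      exact ⟨rfl, by linarith, by linarith, h2⟩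
    · right
      refine ⟨by linarith, ?_⟩
      rw [sub_nonneg, div_le_iff₀ (by positivity)]
      linarith

/-- The real part of `(1 + δ w) / (w + κ)`, up to the factor `|w + κ| ^ 2`. -/
theorem re_mobius_mul_normSq {δ κ w : ℂ} (hw : w + κ ≠ 0) :
    ((1 + δ * w) / (w + κ)).re * ‖w + κ‖ ^ 2 =
      w.re * (1 + δ.re * κ.re + δ.im * κ.im) + κ.re + δ.re * (w.re ^ 2 + w.im ^ 2) -
        w.im * (δ.im * κ.re - δ.re * κ.im) := by
  have hn : Complex.normSq (w + κ) ≠ 0 := by simpa using hw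
  rw [← Complex.normSq_eq_norm_sq, Complex.div_re, ← add_div, div_mul_cancel₀ _ hn]
  simp
  ring

theorem mobius_condition_of_pos {A B d k : ℝ}
    (h : ∀ x y : ℝ, 0 < x → 0 < x * A + k + d * (x ^ 2 + y ^ 2) - y * B) :
    0 ≤ d ∧ 0 ≤ k ∧ B ^ 2 ≤ 4 * (d * k) ∧ (d = 0 → 0 ≤ A) := by
  -- Letting x tend to 0 leaves a nonnegative polynomial in y, of degree at most two.
  have h1 : ∀ y : ℝ, 0 ≤ d * (y * y) + -B * y + k := fun y ↦ by
    have t : Tendsto (fun x : ℝ ↦ x * A + k + d * (x ^ 2 + y ^ 2) - y * B) (𝓝[>] 0)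
        (𝓝 (0 * A + k + d * (0 ^ 2 + y ^ 2) - y * B)) :=
      (Continuous.tendsto (by fun_prop) 0).mono_left nhdsWithin_le_nhds
    have := ge_of_tendsto t (b := 0) (by
      filter_upwards [self_mem_nhdsWithin] with x hx using (h x y hx).le)
    linarith
  have hk : 0 ≤ k := by simpa using h1 0
  have hB := discrim_le_zero h1
  rw [discrim] at hB
  refine ⟨?_, hk, by linarith, fun hd ↦ ?_⟩
  · by_contra! hd
    -- Evaluating at ±y cancels the linear term, and y is so large that d y^2 + k < 0.
    have h2 := h1 ((k + 1) / d - 1)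
    have h3 := h1 (-((k + 1) / d - 1))
    have h4 : (k + 1) / d ≤ 0 := div_nonpos_of_nonneg_of_nonpos (by linarith) hd.le
    have h5 : d * ((k + 1) / d) = k + 1 := by
      have := hd.ne
      field_simp
    have h6 : d * (((k + 1) / d - 1) * ((k + 1) / d - 1)) =
        (k + 1) * ((k + 1) / d) - 2 * (k + 1) + d := by
      linear_combination ((k + 1) / d - 2) * h5
    have h7 : (k + 1) * ((k + 1) / d) ≤ 0 := mul_nonpos_of_nonneg_of_nonpos (by linarith) h4
    linarith
  · by_contra! hA
    -- At this point, with d = 0, the expression equals -1.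
    have h2 := h ((k + 1) / -A) 0 (div_pos (by linarith) (by linarith))
    rw [hd] at h2
    have h3 : (k + 1) / -A * A = -(k + 1) := by
      have := hA.ne
      field_simp
    linarith

theorem mobius_condition_of_mapsTo {δ κ : ℂ} (hq : 1 - δ * κ ≠ 0)
    (hne : ∀ w : RightHalfPlane, (w : ℂ) + κ ≠ 0)
    (hpos : ∀ w : RightHalfPlane, 0 < ((1 + δ * w) / (w + κ)).re) :
    0 ≤ δ.re ∧ 0 ≤ κ.re ∧ ‖1 - δ * κ‖ ≤ 1 + δ.re * κ.re + δ.im * κ.im ∧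
      (δ.re = 0 → 1 - δ * κ ≠ 0) := by
  obtain ⟨hd, hk, hB, hA⟩ := mobius_condition_of_pos
    (A := 1 + δ.re * κ.re + δ.im * κ.im) (B := δ.im * κ.re - δ.re * κ.im) (d := δ.re)
    (k := κ.re) fun x y hx ↦ by
      let w : RightHalfPlane := ⟨⟨x, y⟩, hx⟩
      have h1 := re_mobius_mul_normSq (δ := δ) (hne w)
      have h2 := mul_pos (hpos w) (pow_pos (norm_pos_iff.2 (hne w)) 2)
      rw [h1] at h2
      exact h2
  refine ⟨hd, hk, ?_, fun _ ↦ hq⟩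
  -- The discriminant bounds only the square of the norm, so the sign of the right-hand side must be
  -- found separately.
  have hA' : 0 ≤ 1 + δ.re * κ.re + δ.im * κ.im := by
    rcases hd.eq_or_lt with hd | hd
    · exact hA hd.symm
    rcases hk.eq_or_lt with hk | hk
    · rw [← hk] at hB ⊢
      have h1 : (δ.re * κ.im) ^ 2 ≤ 0 := by nlinarith
      have h2 : δ.re * κ.im = 0 :=
        pow_eq_zero_iff two_ne_zero |>.1 (le_antisymm h1 (sq_nonneg _))
      have h3 : κ.im = 0 := (mul_eq_zero.1 h2).resolve_left hd.ne'
      simp [h3]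
    · have h1 := mul_pos hd hk
      -- The discriminant condition rearranges to 4 re δ re κ (1 + im δ im κ) ≥ (im δ re κ + re δ im
      -- κ)^2.
      have h2 : 0 ≤ 4 * (δ.re * κ.re) * (1 + δ.im * κ.im) := by
        nlinarith [sq_nonneg (δ.im * κ.re + δ.re * κ.im)]
      have := nonneg_of_mul_nonneg_right h2 (by positivity)
      linarith
  refine abs_le_of_sq_le_sq' ?_ hA' |>.2
  rw [← Complex.normSq_eq_norm_sq, Complex.normSq_apply]
  simp
  nlinarith

/-- This is the Schwarz–Pick inequality re w · |G'(w)| ≤ re G(w) with denominators cleared. What is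
left over is re δ (re w)^2 plus a quadratic in im w that is nonnegative by its discriminant. -/
theorem re_mul_norm_le_of_mobius_condition {δ κ w : ℂ} (hw : 0 < w.re) (hne : w + κ ≠ 0)
    (hd : 0 ≤ δ.re) (hk : 0 ≤ κ.re)
    (hA : ‖1 - δ * κ‖ ≤ 1 + δ.re * κ.re + δ.im * κ.im) :
    w.re * ‖1 - δ * κ‖ ≤ ((1 + δ * w) / (w + κ)).re * ‖w + κ‖ ^ 2 := by
  rw [re_mobius_mul_normSq hne]
  have hB : (δ.im * κ.re - δ.re * κ.im) ^ 2 ≤ 4 * (δ.re * κ.re) := by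
    have h1 : ‖1 - δ * κ‖ ^ 2 ≤ (1 + δ.re * κ.re + δ.im * κ.im) ^ 2 := by gcongr
    rw [← Complex.normSq_eq_norm_sq, Complex.normSq_apply] at h1
    simp at h1
    linarith
  have h1 : w.re * ‖1 - δ * κ‖ ≤ w.re * (1 + δ.re * κ.re + δ.im * κ.im) := by gcongr
  have h2 : 0 ≤ δ.re * w.re ^ 2 := by positivity
  have h3 : 0 ≤ κ.re + δ.re * w.im ^ 2 - w.im * (δ.im * κ.re - δ.re * κ.im) := by
    rcases hd.eq_or_lt with hd | hd
    · rw [← hd] at hB ⊢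
      have h4 : δ.im * κ.re = 0 := by
        have : (δ.im * κ.re) ^ 2 ≤ 0 := by nlinarith
        exact pow_eq_zero_iff two_ne_zero |>.1 (le_antisymm this (sq_nonneg _))
      simp [h4, hk]
    · refine nonneg_of_mul_nonneg_right (a := 4 * δ.re) ?_ (by positivity)
      nlinarith [sq_nonneg (2 * δ.re * w.im - (δ.im * κ.re - δ.re * κ.im))]
  linarith

/-! ### The functional equation -/

/-- The values lie in the finite, hence discrete, set of n-th roots of unity. -/
theorem eq_one_of_pow_eq_one_of_continuous {X : Type*} [TopologicalSpace X] [PreconnectedSpace X]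
    {q : X → ℂ} (hq : Continuous q) {n : ℕ} (hn : n ≠ 0) (h : ∀ x, q x ^ n = 1) {x₀ : X}
    (h₀ : q x₀ = 1) (x : X) : q x = 1 := by
  have hfin : {z : ℂ | z ^ n = 1}.Finite := by
    refine (Polynomial.nthRoots n (1 : ℂ)).toFinset.finite_toSet.subset fun z hz ↦ ?_
    simpa [Polynomial.mem_nthRoots (Nat.pos_of_ne_zero hn)] using hz
  rw [← h₀]
  exact isPreconnected_univ.constant_of_mapsTo hfin.isDiscrete hq.continuousOn
    (fun y _ ↦ h y) (Set.mem_univ x) (Set.mem_univ x₀)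

instance : PreconnectedSpace RightHalfPlane :=
  Subtype.preconnectedSpace RightHalfPlane.isPreconnected_setOf

section FunctionalEquation

variable {n : ℕ} {f : RightHalfPlane → ℂ} {g : RightHalfPlane → RightHalfPlane}

theorem eq_zero_of_apply_eq_zero
    (hs : ∀ z w : RightHalfPlane,
      f w * (1 + (g z : ℂ) * w) ^ n = f z * (1 + (z : ℂ) * g w) ^ n)
    {z : RightHalfPlane} (hz : f z = 0) (w : RightHalfPlane) : f w = 0 := by
  have := hs z w
  rw [hz, zero_mul] at this
  exact (mul_eq_zero.1 this).resolve_right (pow_ne_zero _ (one_add_mul_ne_zero _ _))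

theorem apply_eq_of_mul_pow_eq
    (hs : ∀ z w : RightHalfPlane,
      f w * (1 + (g z : ℂ) * w) ^ n = f z * (1 + (z : ℂ) * g w) ^ n)
    (w : RightHalfPlane) :
    f w * (1 + (g one : ℂ) * w) ^ n = f one * (1 + (g w : ℂ)) ^ n := by
  simpa [one] using hs one w

/-- Comparing z and w with `one` eliminates f and gives this identity between n-th powers. The
quotient of the two sides is continuous in z and equals 1 at z = w, so it is 1 throughout. -/
theorem cross_eq_of_mul_pow_eq (hn : n ≠ 0) (hg : Continuous g)
    (hs : ∀ z w : RightHalfPlane,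
      f w * (1 + (g z : ℂ) * w) ^ n = f z * (1 + (z : ℂ) * g w) ^ n)
    (h1 : f one ≠ 0) (z w : RightHalfPlane) :
    (1 + (g w : ℂ)) * (1 + (g z : ℂ) * w) * (1 + (g one : ℂ) * z) =
      (1 + (g z : ℂ)) * (1 + (z : ℂ) * g w) * (1 + (g one : ℂ) * w) := by
  have hD : ∀ z : RightHalfPlane,
      (1 + (g z : ℂ)) * (1 + (z : ℂ) * g w) * (1 + (g one : ℂ) * w) ≠ 0 := fun z ↦
    mul_ne_zero (mul_ne_zero (one_add_ne_zero (g z).2) (one_add_mul_ne_zero _ _))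
      (one_add_mul_ne_zero _ _)
  have hc : Continuous fun z ↦ (g z : ℂ) := continuous_subtype_val.comp hg
  have key := eq_one_of_pow_eq_one_of_continuous
    (q := fun z : RightHalfPlane ↦
      (1 + (g w : ℂ)) * (1 + (g z : ℂ) * w) * (1 + (g one : ℂ) * z) /
        ((1 + (g z : ℂ)) * (1 + (z : ℂ) * g w) * (1 + (g one : ℂ) * w)))
    (Continuous.div (by fun_prop) (by fun_prop) hD) hn (fun z ↦ ?_) (x₀ := w) ?_ z
  · rwa [div_eq_one_iff_eq (hD z)] at key
  · rw [div_pow, div_eq_one_iff_eq (pow_ne_zero _ (hD z))]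
    have e1 := apply_eq_of_mul_pow_eq hs w
    have e2 := apply_eq_of_mul_pow_eq hs z
    have e3 := hs z w
    apply mul_left_cancel₀ h1
    simp only [mul_pow]
    linear_combination -(1 + (g z : ℂ) * w) ^ n * (1 + (g one : ℂ) * z) ^ n * e1 +
      (1 + (g one : ℂ) * w) ^ n * (1 + (g one : ℂ) * z) ^ n * e3 +
      (1 + (g one : ℂ) * w) ^ n * (1 + (z : ℂ) * g w) ^ n * e2
  · rw [div_eq_one_iff_eq (hD w)]
    ring

theorem im_eq_zero_of_mul_mapsTo {a : ℂ}
    (h : ∀ w : RightHalfPlane, 0 < (a * w).re) : a.im = 0 := by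
  by_contra ha
  -- The product with `a` has real part zero at this point.
  have := h ⟨⟨1, a.re / a.im⟩, one_pos⟩
  simp at this
  field_simp at this
  simp at this

/-- For fixed z the cross identity is affine in g(w) and in w. The coefficient of w on the left
equals the constant term on the right; dividing by it gives the shape (1 + δw)/(w + κ), and its
vanishing gives a dilation. -/
theorem classification_of_mul_pow_eq (hn : n ≠ 0) (hg : Continuous g)
    (hs : ∀ z w : RightHalfPlane,
      f w * (1 + (g z : ℂ) * w) ^ n = f z * (1 + (z : ℂ) * g w) ^ n)
    (h1 : f one ≠ 0) :
    (∃ α β : ℂ, 0 < α.re ∧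
      ∀ w : RightHalfPlane, (g w : ℂ) = α ∧ f w = β / (1 + α * (w : ℂ)) ^ n) ∨
    (∃ (lam : ℝ) (θ : ℂ), 0 < lam ∧
      ∀ w : RightHalfPlane, (g w : ℂ) = (lam : ℂ) * (w : ℂ) ∧ f w = θ) ∨
    (∃ δ κ r : ℂ, 1 - δ * κ ≠ 0 ∧ (∀ w : RightHalfPlane, (w : ℂ) + κ ≠ 0) ∧
      ∀ w : RightHalfPlane, (g w : ℂ) = (1 + δ * w) / (w + κ) ∧ f w = r / ((w : ℂ) + κ) ^ n) := by
  have hf := apply_eq_of_mul_pow_eq hs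
  have hcross := cross_eq_of_mul_pow_eq hn hg hs h1
  set a : ℂ := (g one).1 with ha
  have hare : 0 < a.re := (g one).2
  have ha2 : ∀ w : RightHalfPlane, 1 + a * w ≠ 0 := one_add_mul_ne_zero _
  -- The cross identity is trivial at z = `one`, so a second point is needed.
  let two : RightHalfPlane := ⟨2, by simp⟩
  set b : ℂ := (g two).1 with hb
  have hg2 : ∀ w : RightHalfPlane,
      (g w : ℂ) * (2 * a - 1 - 2 * b + (b - 2 * a) * w) = b - 2 * a + (a - b - a * b) * w :=
    fun w ↦ by
      have : (1 + (g w : ℂ)) * (1 + b * w) * (1 + a * 2) =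
        (1 + b) * (1 + 2 * g w) * (1 + a * w) := hcross two w
      linear_combination this
  by_cases hB : b - 2 * a = 0
  · right; left
    have hb' : b = 2 * a := by linear_combination hB
    have h3 : 1 + 2 * a ≠ 0 := one_add_ne_zero (by simpa using hare)
    have hga : ∀ w : RightHalfPlane, (g w : ℂ) = a * w := fun w ↦ by
      have h2 := hg2 w
      rw [hb'] at h2
      apply mul_right_cancel₀ h3
      linear_combination -h2
    have him : a.im = 0 := im_eq_zero_of_mul_mapsTo fun w ↦ hga w ▸ (g w).2
    have hre : ((a.re : ℝ) : ℂ) = a := Complex.ext rfl (by simp [him])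
    refine ⟨a.re, f one, hare, fun w ↦ ⟨by rw [hre, hga], ?_⟩⟩
    have h2 := hf w
    rw [hga] at h2
    exact mul_right_cancel₀ (pow_ne_zero _ (ha2 w)) h2
  obtain ⟨κ, hκ⟩ : ∃ κ, (b - 2 * a) * κ = 2 * a - 1 - 2 * b := ⟨_, mul_div_cancel₀ _ hB⟩
  obtain ⟨δ, hδ⟩ : ∃ δ, (b - 2 * a) * δ = a - b - a * b := ⟨_, mul_div_cancel₀ _ hB⟩
  have hg3 : ∀ w : RightHalfPlane, (g w : ℂ) * (w + κ) = 1 + δ * w := fun w ↦ by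
    apply mul_left_cancel₀ hB
    linear_combination hg2 w + (g w : ℂ) * hκ - (w : ℂ) * hδ
  by_cases hq : 1 - δ * κ = 0
  · left
    have hg4 : ∀ w : RightHalfPlane, (w : ℂ) + κ ≠ 0 → (g w : ℂ) = δ := fun w hw ↦ by
      apply mul_right_cancel₀ hw
      linear_combination hg3 w + hq
    -- At this stage -κ could still lie in the half-plane, but it cannot equal both 1 and 2.
    have hδre : 0 < δ.re := by
      by_cases h : (one : ℂ) + κ = 0
      · rw [← hg4 two fun h' ↦ ?_]
        · exact (g two).2
        · have : (1 : ℂ) = 2 := by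
            change (1 : ℂ) + κ = 0 at h
            change (2 : ℂ) + κ = 0 at h'
            linear_combination h - h'
          norm_num at this
      · rw [← hg4 one h]
        exact (g one).2
    have hne : ∀ w : RightHalfPlane, (w : ℂ) + κ ≠ 0 := fun w hw ↦
      one_add_mul_ne_zero ⟨δ, hδre⟩ w (by linear_combination δ * hw + hq)
    refine ⟨δ, f one * (1 + δ) ^ n, hδre, fun w ↦ ⟨hg4 w (hne w), ?_⟩⟩
    have haδ : a = δ := hg4 one (hne one)
    rw [eq_div_iff (haδ ▸ pow_ne_zero _ (ha2 w)), ← haδ, hf w, hg4 w (hne w), haδ]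
  · right; right
    have hne : ∀ w : RightHalfPlane, (w : ℂ) + κ ≠ 0 := fun w hw ↦ by
      have h2 := hg3 w
      rw [hw, mul_zero] at h2
      exact hq (by linear_combination -h2 - δ * hw)
    refine ⟨δ, κ, f one * (1 + κ) ^ n, hq, hne, fun w ↦
      ⟨by rw [eq_div_iff (hne w), hg3 w], ?_⟩⟩
    have hone : a * (1 + κ) = 1 + δ * 1 := hg3 one
    rw [mul_one] at hone
    -- Through this factorization the equation relating f(w) to f(1) yields f(w)(w + κ)^n.
    have e : (1 + (g w : ℂ)) * (w + κ) = (1 + κ) * (1 + a * w) := by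
      linear_combination hg3 w - (w : ℂ) * hone
    rw [eq_div_iff (pow_ne_zero _ (hne w))]
    apply mul_right_cancel₀ (pow_ne_zero n (ha2 w))
    calc f w * ((w : ℂ) + κ) ^ n * (1 + a * w) ^ n
        = f one * ((1 + (g w : ℂ)) * (w + κ)) ^ n := by
          rw [mul_right_comm, hf w, mul_assoc, mul_pow]
      _ = _ := by rw [e, mul_pow, mul_assoc]

end FunctionalEquation

/-! ### Boundedness and the main theorem -/

open BergmanSpace in
-- The symbol is not injective, so no change of variables is used: the operator is k ↦ k(α)φ with φ
-- a multiple of a conjugated kernel.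
theorem isBoundedOperator_of_const {ℓ : ℕ} {f : RightHalfPlane → ℂ}
    {g : RightHalfPlane → RightHalfPlane} {α β : ℂ} (hα : 0 < α.re)
    (h : ∀ w : RightHalfPlane, (g w : ℂ) = α ∧ f w = β / (1 + α * (w : ℂ)) ^ (ℓ + 2)) :
    IsBoundedOperator (maxWeightedComp ℓ f g) := by
  obtain ⟨c, hc0, hc⟩ := exists_kernel_eq ℓ
  let a : RightHalfPlane := ⟨α, hα⟩
  have hga : ∀ w, g w = a := fun w ↦ Subtype.ext (h w).1
  let φ : BergmanSpace ℓ := (β / conj c) • cStar ℓ (kernel ℓ a)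
  have hφ : ∀ w, φ w = f w := fun w ↦ by
    have hc' : conj c ≠ 0 := by simpa using hc0
    change (β / conj c) * cStar ℓ (kernel ℓ a) w = f w
    rw [cStar_kernel_apply hc, (h w).2]
    exact div_mul_div_cancel₀ hc'
  refine isBoundedOperator_maxWeightedComp (L := ‖kernel ℓ a‖ * ‖φ‖) fun k ↦ ?_
  have e : (fun z ↦ f z * k (g z)) = ⇑(k a • φ) := by
    funext z
    rw [coe_smul, hφ, hga, mul_comm]
  have hm : (fun z ↦ f z * k (g z)) ∈ bergmanSubmodule ℓ := e ▸ (k a • φ).mem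
  refine ⟨hm, ?_⟩
  have e2 : ofMem _ hm = k a • φ := DFunLike.coe_injective e
  rw [e2, norm_smul, ← inner_kernel a k, mul_right_comm]
  gcongr
  exact norm_inner_le_norm _ _

theorem isBoundedOperator_of_dilation {ℓ : ℕ} {f : RightHalfPlane → ℂ}
    {g : RightHalfPlane → RightHalfPlane} (hf : IsAnalyticOnHalfPlane f) {lam : ℝ} {θ : ℂ}
    (hlam : 0 < lam) (h : ∀ w : RightHalfPlane, (g w : ℂ) = (lam : ℂ) * (w : ℂ) ∧ f w = θ) :
    IsBoundedOperator (maxWeightedComp ℓ f g) := by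
  refine isBoundedOperator_maxWeightedComp (weightedComp_mem_and_norm_le
    -- The weight contributes λ^ℓ and the Jacobian λ^2, giving equality.
    (M := ‖θ‖ ^ 2 / lam ^ (ℓ + 2)) (by positivity) hf (F := fun _ ↦ θ)
    (G := fun z ↦ lam * z) (G' := fun _ ↦ lam) (fun w ↦ (h w).2) (fun w ↦ (h w).1)
    (fun z _ ↦ by simpa using (hasDerivAt_id z).const_mul (lam : ℂ))
    (fun z _ w _ hzw ↦ by simpa [hlam.ne'] using hzw) fun z hz ↦ ?_)
  rw [Complex.norm_real, Real.norm_of_nonneg hlam.le, Complex.re_ofReal_mul]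
  apply le_of_eq
  field_simp
  ring

/-- The constant is obtained by raising the Schwarz–Pick inequality to the power ℓ and using |G'| =
|1 - δκ| / |z + κ|^2 for the two remaining powers. -/
theorem isBoundedOperator_of_mobius {ℓ : ℕ} {f : RightHalfPlane → ℂ}
    {g : RightHalfPlane → RightHalfPlane} (hf : IsAnalyticOnHalfPlane f) {δ κ r : ℂ}
    (hd : 0 ≤ δ.re) (hk : 0 ≤ κ.re) (hA : ‖1 - δ * κ‖ ≤ 1 + δ.re * κ.re + δ.im * κ.im)
    (hq : 1 - δ * κ ≠ 0)
    (h : ∀ w : RightHalfPlane, (g w : ℂ) = (1 + δ * w) / (w + κ) ∧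
      f w = r / ((w : ℂ) + κ) ^ (ℓ + 2)) :
    IsBoundedOperator (maxWeightedComp ℓ f g) := by
  have hne : ∀ z : ℂ, 0 < z.re → z + κ ≠ 0 := fun z hz h0 ↦ by
    have := congrArg Complex.re h0
    simp at this
    linarith
  have hq' : 0 < ‖1 - δ * κ‖ := norm_pos_iff.2 hq
  refine isBoundedOperator_maxWeightedComp (weightedComp_mem_and_norm_le
    (M := ‖r‖ ^ 2 / ‖1 - δ * κ‖ ^ (ℓ + 2)) (by positivity) hf
    (F := fun z ↦ r / (z + κ) ^ (ℓ + 2)) (G := fun z ↦ (1 + δ * z) / (z + κ))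
    (G' := fun z ↦ -(1 - δ * κ) / (z + κ) ^ 2) (fun w ↦ (h w).2) (fun w ↦ (h w).1)
    (fun z hz ↦ ?_) (fun z hz w hw hzw ↦ ?_) fun z hz ↦ ?_)
  · have h1 := (((hasDerivAt_id z).const_mul δ).const_add 1).fun_div
      ((hasDerivAt_id z).add_const κ) (hne z hz)
    have e : -(1 - δ * κ) / (z + κ) ^ 2 =
        (δ * 1 * (id z + κ) - (1 + δ * id z) * 1) / (id z + κ) ^ 2 := by
      rw [id]
      ring
    rw [e]
    exact h1
  · have hz' := hne z hz
    have hw' := hne w hw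
    rw [div_eq_div_iff hz' hw'] at hzw
    have : (1 - δ * κ) * (z - w) = 0 := by linear_combination -hzw
    exact sub_eq_zero.1 ((mul_eq_zero.1 this).resolve_left hq)
  · have hz' : 0 < ‖z + κ‖ := norm_pos_iff.2 (hne z hz)
    have h1 := re_mul_norm_le_of_mobius_condition hz (hne z hz) hd hk hA
    have h2 := pow_le_pow_left₀ (by positivity) h1 ℓ
    rw [mul_pow, mul_pow] at h2
    rw [norm_div, norm_div, norm_neg, norm_pow, norm_pow]
    generalize ‖1 - δ * κ‖ = Q at h2 hq' ⊢
    calc z.re ^ ℓ * (‖r‖ / ‖z + κ‖ ^ (ℓ + 2)) ^ 2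
        = (z.re ^ ℓ * Q ^ ℓ) *
            (‖r‖ ^ 2 / (Q ^ ℓ * (‖z + κ‖ ^ (ℓ + 2)) ^ 2)) := by
          field_simp
      _ ≤ (((1 + δ * z) / (z + κ)).re ^ ℓ * (‖z + κ‖ ^ 2) ^ ℓ) *
            (‖r‖ ^ 2 / (Q ^ ℓ * (‖z + κ‖ ^ (ℓ + 2)) ^ 2)) := by gcongr
      _ = _ := by
          field_simp
          ring

theorem isBoundedOperator_of_eq_zero {ℓ : ℕ} {f : RightHalfPlane → ℂ}
    {g : RightHalfPlane → RightHalfPlane} (h : ∀ w, f w = 0) :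
    IsBoundedOperator (maxWeightedComp ℓ f g) := by
  refine isBoundedOperator_maxWeightedComp (L := 0) fun k ↦ ?_
  have e : (fun z ↦ f z * k (g z)) = ⇑(0 : BergmanSpace ℓ) := by
    funext z
    rw [h, zero_mul, BergmanSpace.coe_zero]
  have hm : (fun z ↦ f z * k (g z)) ∈ bergmanSubmodule ℓ := e ▸ (0 : BergmanSpace ℓ).mem
  refine ⟨hm, ?_⟩
  have e2 : BergmanSpace.ofMem _ hm = 0 := DFunLike.coe_injective e
  rw [e2, norm_zero, zero_mul]

theorem div_add_eq_mobius {δ κ w : ℂ} (hw : w + κ ≠ 0) :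
    δ + (1 - δ * κ) / (w + κ) = (1 + δ * w) / (w + κ) := by
  field_simp
  ring

/-- Each of the listed pairs gives a bounded operator satisfying the kernel identity. -/
theorem isBoundedOperator_and_mul_pow_eq {ℓ : ℕ} {f : RightHalfPlane → ℂ}
    {g : RightHalfPlane → RightHalfPlane} (hf : IsAnalyticOnHalfPlane f)
    (h : (∀ w, f w = 0) ∨
      (∃ α β : ℂ, 0 < α.re ∧
        ∀ w : RightHalfPlane, (g w : ℂ) = α ∧ f w = β / (1 + α * (w : ℂ)) ^ (ℓ + 2)) ∨
      (∃ (lam : ℝ) (θ : ℂ), 0 < lam ∧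
        ∀ w : RightHalfPlane, (g w : ℂ) = (lam : ℂ) * (w : ℂ) ∧ f w = θ) ∨
      (∃ δ κ r : ℂ,
        ((δ.re = 0 ∧ (δ * κ).im = 0 ∧ (δ * κ).re < 1 ∧ 0 ≤ κ.re) ∨
          (-δ.re < 0 ∧
            0 ≤ κ.re - ((δ * κ - 1).re + ‖δ * κ - 1‖) / (2 * δ.re))) ∧
        ∀ w : RightHalfPlane, (g w : ℂ) = δ + (1 - δ * κ) / ((w : ℂ) + κ) ∧
          f w = r / ((w : ℂ) + κ) ^ (ℓ + 2))) :
    IsBoundedOperator (maxWeightedComp ℓ f g) ∧ ∀ z w : RightHalfPlane,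
      f w * (1 + (g z : ℂ) * w) ^ (ℓ + 2) = f z * (1 + (z : ℂ) * g w) ^ (ℓ + 2) := by
  rcases h with h | ⟨α, β, hα, h⟩ | ⟨lam, θ, hlam, h⟩ | ⟨δ, κ, r, hc, h⟩
  · exact ⟨isBoundedOperator_of_eq_zero h, fun z w ↦ by rw [h, h, zero_mul, zero_mul]⟩
  · refine ⟨isBoundedOperator_of_const hα h, fun z w ↦ ?_⟩
    have n1 := pow_ne_zero (ℓ + 2) (one_add_mul_ne_zero ⟨α, hα⟩ w)
    have n2 := pow_ne_zero (ℓ + 2) (one_add_mul_ne_zero ⟨α, hα⟩ z)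
    rw [(h w).2, (h z).2, (h w).1, (h z).1, mul_comm (z : ℂ) α, div_mul_cancel₀ _ n1,
      div_mul_cancel₀ _ n2]
  · refine ⟨isBoundedOperator_of_dilation hf hlam h, fun z w ↦ ?_⟩
    rw [(h w).2, (h z).2, (h w).1, (h z).1, mul_left_comm (z : ℂ), mul_assoc]
  · obtain ⟨hd, hk, hA, hq⟩ := (mobius_condition_iff δ κ).1 hc
    have hne : ∀ w : RightHalfPlane, (w : ℂ) + κ ≠ 0 := fun w h0 ↦ by
      have := congrArg Complex.re h0
      simp at this
      linarith [w.2]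
    have h' : ∀ w : RightHalfPlane, (g w : ℂ) = (1 + δ * w) / (w + κ) ∧
        f w = r / ((w : ℂ) + κ) ^ (ℓ + 2) := fun w ↦
      ⟨(h w).1.trans (div_add_eq_mobius (hne w)), (h w).2⟩
    refine ⟨?_, fun z w ↦ ?_⟩
    · by_cases hq0 : 1 - δ * κ = 0
      · have hδ : 0 < δ.re := lt_of_le_of_ne hd fun h0 ↦ hq h0.symm hq0
        refine isBoundedOperator_of_const (α := δ) (β := r * δ ^ (ℓ + 2)) hδ fun w ↦
          ⟨by rw [(h w).1, hq0, zero_div, add_zero], ?_⟩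
        have hδ0 : δ ≠ 0 := fun h0 ↦ by simp [h0] at hδ
        have e : 1 + δ * (w : ℂ) = δ * (w + κ) := by linear_combination hq0
        rw [(h w).2, e, mul_pow, mul_comm r, mul_div_mul_left _ _ (pow_ne_zero _ hδ0)]
      · exact isBoundedOperator_of_mobius hf hd hk hA hq0 h'
    · have nz := hne z
      have nw := hne w
      -- Both fractions have the same numerator, symmetric in z and w.
      have e1 : 1 + (1 + δ * z) / (z + κ) * (w : ℂ) = (z + κ + w + δ * z * w) / (z + κ) := by
        field_simp
        ring
      have e2 : 1 + (z : ℂ) * ((1 + δ * w) / (w + κ)) = (z + κ + w + δ * z * w) / (w + κ) := by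
        field_simp
        ring
      rw [(h w).2, (h z).2, (h' w).1, (h' z).1, e1, e2, div_pow, div_pow]
      field_simp

end

theorem mainTheorem6 (ℓ : ℕ) (f : RightHalfPlane → ℂ) (g : RightHalfPlane → RightHalfPlane)
    (hf : IsAnalyticOnHalfPlane f) (hg : IsAnalyticOnHalfPlane fun z ↦ (g z : ℂ)) :
    (IsCSelfAdjoint (cStar ℓ) (maxWeightedComp ℓ f g) ↔
      (∀ w, f w = 0) ∨
      (∃ α β : ℂ, 0 < α.re ∧
        ∀ w : RightHalfPlane, (g w : ℂ) = α ∧ f w = β / (1 + α * (w : ℂ)) ^ (ℓ + 2)) ∨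
      (∃ (lam : ℝ) (θ : ℂ), 0 < lam ∧
        ∀ w : RightHalfPlane, (g w : ℂ) = (lam : ℂ) * (w : ℂ) ∧ f w = θ) ∨
      (∃ δ κ r : ℂ,
        ((δ.re = 0 ∧ (δ * κ).im = 0 ∧ (δ * κ).re < 1 ∧ 0 ≤ κ.re) ∨
          (-δ.re < 0 ∧
            0 ≤ κ.re - ((δ * κ - 1).re + ‖δ * κ - 1‖) / (2 * δ.re))) ∧
        ∀ w : RightHalfPlane, (g w : ℂ) = δ + (1 - δ * κ) / ((w : ℂ) + κ) ∧
          f w = r / ((w : ℂ) + κ) ^ (ℓ + 2))) ∧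
    (IsCSelfAdjoint (cStar ℓ) (maxWeightedComp ℓ f g) →
      IsBoundedOperator (maxWeightedComp ℓ f g)) := by
  -- Boundedness is read off the list of pairs, so it reuses the equivalence.
  refine (fun hiff : _ ↔ _ ↦ ⟨hiff, fun hT ↦
    (isBoundedOperator_and_mul_pow_eq hf (hiff.1 hT)).1⟩) ⟨fun hT ↦ ?_, fun h ↦ ?_⟩
  · have hs := hT.mul_pow_eq
    by_cases h1 : f RightHalfPlane.one = 0
    · exact Or.inl (eq_zero_of_apply_eq_zero hs h1)
    right
    have hgc : Continuous g := continuous_induced_rng.2 hg.continuous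
    rcases classification_of_mul_pow_eq (by omega) hgc hs h1 with h | h | ⟨δ, κ, r, hq, hne, h⟩
    · exact Or.inl h
    · exact Or.inr (Or.inl h)
    · refine Or.inr (Or.inr ⟨δ, κ, r, (mobius_condition_iff δ κ).2
        (mobius_condition_of_mapsTo hq hne fun w ↦ (h w).1 ▸ (g w).2), fun w ↦ ⟨?_, (h w).2⟩⟩)
      rw [(h w).1, div_add_eq_mobius (hne w)]
  · obtain ⟨hb, hs⟩ := isBoundedOperator_and_mul_pow_eq hf h
    exact isCSelfAdjoint_of_mul_pow_eq hb hs
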